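/- Let $M$ be a CR manifold of hypersurface type: an orientable smooth manifold of real dimension $2n+1$ with a smooth complex subbundle $T^{1,0}\subset \mathbb C\otimes TM$ of rank $n$ such that $T^{1,0}\cap T^{0,1}=0$, where $T^{0,1}=\overline{T^{1,0}}$, and $[\Gamma(T^{0,1}),\Gamma(T^{0,1})]\subset\Gamma(T^{0,1})$. A trivialization is a purely imaginary, nowhere vanishing smooth $1$-form $\eta$ on $M$ annihilating $T^{1,0}\oplus T^{0,1}$. Its Levi form is $\lambda_\eta(L_p,L'_p)=\eta([L,\overline{L'}]_p)$, with $L,L'\in\Gamma(T^{1,0})$ arbitrary extensions, and its null space is $\mathcal N_p=\{v\in T^{1,0}_p:\lambda_\eta(v,w)=0\ \forall w\in T^{1,0}_p\}$, which does not depend on $\eta$. The trivialization $\eta$ is positive if $\lambda_\eta(v,v)\ge 0$ for all $v\in T^{1,0}$; $M$ is pseudoconvex if it has a positive trivialization. For a purely imaginary smooth section $T$ of $\mathbb C\otimes TM$ with $\eta(T)=1$, let $\alpha_\eta=-\mathcal L_T\eta$, extended complex linearly, and let $\omega_\eta$ be the form that equals $\alpha_\eta$ on $T^{1,0}$ and vanishes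 on $T^{0,1}\oplus\mathbb C T$. Put $$\bar\partial_b\omega_\eta(L_p,\overline{L'}_p)=\overline{L'}_p\,\omega_\eta(L)+\omega_\eta([L,\overline{L'}]_p),\qquad (\omega_\eta\wedge\overline{\omega}_\eta)(L_p,\overline{L}_p)=|\omega_\eta(L_p)|^2 ,$$ again with arbitrary extensions $L,L'\in\Gamma(T^{1,0})$. If $M$ is pseudoconvex, these define Hermitian forms on $\mathcal N_p$ that do not depend on $T$. For such a form $q$, "$q>0$ on $\mathcal N$ over $S\subset M$" means $q(v,\bar v)>0$ for all $p\in S$ and all $0\ne v\in\mathcal N_p$; and $q<0$ means $-q>0$. For compact pseudoconvex $M$ let $$DF_s(M)=\sup\Big\{0<\gamma<1:\ \bar\partial_b\omega_\eta-\tfrac{\gamma}{1-\gamma}\,\omega_\eta\wedge\overline\omega_\eta>0\text{ on }\mathcal N\text{ over } M\text{ for some positive trivialization }\eta\Big\},$$ $$S_s(M)=\inf\Big\{\gamma>1:\ -\bar\partial_b\omega_\eta-\tfrac{\gamma}{\gamma-1}\,\omega_\eta\wedge\overline\omega_\eta>0\text{ on }\mathcal N\text{ over } M\text{ for some positive trivialization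 }\eta\Big\},$$ with the conventions $\sup\emptyset=0$ and $\inf\emptyset=\infty$. **Proposition.** Let $M$ be a compact pseudoconvex CR manifold of hypersurface type, let $A$ be a nonempty compact complex manifold of positive dimension, and let $\iota\colon A\to M$ be a CR embedding, that is, a smooth embedding whose differential maps $T^{1,0}A$ into $T^{1,0}$. Then there is no positive trivialization $\eta$ of $M$ such that $\bar\partial_b\omega_\eta>0$ on $\mathcal N$ over $\iota(A)$, and none such that $\bar\partial_b\omega_\eta<0$ on $\mathcal N$ over $\iota(A)$. In particular, $DF_s(M)=0$ and $S_s(M)=\infty$. -/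

import Mathlib

open Set Topology Manifold VectorField
open scoped ContDiff TensorProduct

noncomputable section

namespace CRGeometry

/-! ### Complexification of a real vector space -/

section Complexification

variable {V : Type*} [AddCommGroup V] [Module ℝ V]

/-- The real part `ℂ ⊗ V → V`, with `z ⊗ v ↦ (Re z) v`. -/
def reC : ℂ ⊗[ℝ] V →ₗ[ℝ] V :=
  (TensorProduct.lid ℝ V).toLinearMap ∘ₗ LinearMap.rTensor V Complex.reLm

/-- The imaginary part `ℂ ⊗ V → V`, with `z ⊗ v ↦ (Im z) v`. -/
def imC : ℂ ⊗[ℝ] V →ₗ[ℝ] V :=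
  (TensorProduct.lid ℝ V).toLinearMap ∘ₗ LinearMap.rTensor V Complex.imLm

/-- Complex conjugation on `ℂ ⊗ V`, with `z ⊗ v ↦ z̄ ⊗ v`. -/
def conjC : ℂ ⊗[ℝ] V →ₗ[ℝ] ℂ ⊗[ℝ] V :=
  LinearMap.rTensor V Complex.conjAe.toLinearMap

/-- The complex vector `x + i y`. -/
def mkC (x y : V) : ℂ ⊗[ℝ] V := (1 : ℂ) ⊗ₜ[ℝ] x + Complex.I ⊗ₜ[ℝ] y

@[simp] lemma reC_tmul (z : ℂ) (v : V) : reC (z ⊗ₜ[ℝ] v) = z.re • v := by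
  simp [reC]

@[simp] lemma imC_tmul (z : ℂ) (v : V) : imC (z ⊗ₜ[ℝ] v) = z.im • v := by
  simp [imC]

@[simp] lemma conjC_tmul (z : ℂ) (v : V) :
    conjC (z ⊗ₜ[ℝ] v) = (starRingEnd ℂ z) ⊗ₜ[ℝ] v := by
  simp [conjC]

lemma mkC_reC_imC (z : ℂ ⊗[ℝ] V) : mkC (reC z) (imC z) = z := by
  induction z with
  | zero => simp [mkC]
  | add a b ha hb =>
    rw [map_add, map_add]
    conv_rhs => rw [← ha, ← hb]
    simp only [mkC, TensorProduct.tmul_add]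
    abel
  | tmul c v =>
    simp only [mkC, reC_tmul, imC_tmul, ← TensorProduct.smul_tmul, ← TensorProduct.add_tmul]
    congr 1
    apply Complex.ext <;> simp

@[simp] lemma conjC_conjC (z : ℂ ⊗[ℝ] V) : conjC (conjC z) = z := by
  induction z with
  | zero => simp
  | add a b ha hb => simp [ha, hb]
  | tmul c v => simp

lemma conjC_smul (c : ℂ) (z : ℂ ⊗[ℝ] V) :
    conjC (c • z) = (starRingEnd ℂ c) • conjC z := by
  induction z with
  | zero => simp
  | add a b ha hb => simp [ha, hb]
  | tmul d v => simp [TensorProduct.smul_tmul']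

/-- The conjugate `S̄` of a complex subspace `S ⊆ ℂ ⊗ V`. -/
def conjSubmodule (S : Submodule ℂ (ℂ ⊗[ℝ] V)) : Submodule ℂ (ℂ ⊗[ℝ] V) where
  carrier := {z | conjC z ∈ S}
  add_mem' := fun {a b} ha hb => by
    simpa using S.add_mem ha hb
  zero_mem' := by simp
  smul_mem' := fun c z hz => by
    simpa [conjC_smul] using S.smul_mem (starRingEnd ℂ c) hz

@[simp] lemma mem_conjSubmodule {S : Submodule ℂ (ℂ ⊗[ℝ] V)} {z : ℂ ⊗[ℝ] V} :
    z ∈ conjSubmodule S ↔ conjC z ∈ S := Iff.rfl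

lemma finrank_conjSubmodule (S : Submodule ℂ (ℂ ⊗[ℝ] V)) :
    Module.finrank ℂ (conjSubmodule S) = Module.finrank ℂ S := by
  unfold Module.finrank
  congr 1
  refine rank_eq_of_equiv_equiv (starRingEnd ℂ)
    { toFun := fun z => ⟨conjC z.1, z.2⟩
      invFun := fun z => ⟨conjC z.1, by simp⟩
      left_inv := fun z => by simp
      right_inv := fun z => by simp
      map_add' := fun a b => by ext; simp } (starRingAut (R := ℂ)).bijective ?_
  intro c z
  ext
  simp [conjC_smul]

end Complexification

/-! ### Complex vector fields on a real manifold -/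

section Fields

variable (E : Type*) [NormedAddCommGroup E] [NormedSpace ℝ E]
  (M : Type*) [TopologicalSpace M] [ChartedSpace E M]

/-- The complexified tangent space `ℂ ⊗ T_p M`. -/
abbrev CTangent {M : Type*} [TopologicalSpace M] [ChartedSpace E M] (p : M) : Type _ :=
  ℂ ⊗[ℝ] TangentSpace 𝓘(ℝ, E) p

/-- (Not necessarily smooth) sections of `ℂ ⊗ TM`. -/
abbrev CField : Type _ := ∀ p : M, CTangent E p

variable {E M}

/-- Smoothness on a set `s` of a complex vector field: its real and imaginary parts are smooth. -/
def SmoothFieldOn [IsManifold 𝓘(ℝ, E) ∞ M] (Z : CField E M) (s : Set M) : Prop :=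
  ContMDiffOn 𝓘(ℝ, E) (𝓘(ℝ, E).prod 𝓘(ℝ, E)) ∞
      (fun p => (⟨p, reC (Z p)⟩ : TangentBundle 𝓘(ℝ, E) M)) s ∧
    ContMDiffOn 𝓘(ℝ, E) (𝓘(ℝ, E).prod 𝓘(ℝ, E)) ∞
      (fun p => (⟨p, imC (Z p)⟩ : TangentBundle 𝓘(ℝ, E) M)) s

/-- A smooth section of `ℂ ⊗ TM`. -/
def SmoothField [IsManifold 𝓘(ℝ, E) ∞ M] (Z : CField E M) : Prop := SmoothFieldOn Z univ

/-- The complex conjugate of a complex vector field. -/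
def conjField (Z : CField E M) : CField E M := fun p => conjC (Z p)

/-- The complex bilinear extension of the Lie bracket to complex vector fields:
`[X + iY, X' + iY'] = [X, X'] - [Y, Y'] + i ([X, Y'] + [Y, X'])`. -/
def bracket (Z W : CField E M) : CField E M := fun p =>
  mkC
    (mlieBracket 𝓘(ℝ, E) (fun q => reC (Z q)) (fun q => reC (W q)) p
      - mlieBracket 𝓘(ℝ, E) (fun q => imC (Z q)) (fun q => imC (W q)) p)
    (mlieBracket 𝓘(ℝ, E) (fun q => reC (Z q)) (fun q => imC (W q)) p
      + mlieBracket 𝓘(ℝ, E) (fun q => imC (Z q)) (fun q => reC (W q)) p)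

/-- The derivative `z f` of a complex function `f` along a complex tangent vector `z`. -/
def deriv {p : M} (z : CTangent E p) (f : M → ℂ) : ℂ :=
  (mvfderiv 𝓘(ℝ, E) f p).toLinearMap.liftBaseChange ℂ z

end Fields

/-! ### CR structures of hypersurface type -/

/-- A CR structure of hypersurface type on the manifold `M` of dimension `2n + 1`: a smooth complex
subbundle `T¹⁰ ⊆ ℂ ⊗ TM` of rank `n` with `T¹⁰ ∩ T⁰¹ = 0`, where `T⁰¹` is the conjugate of
`T¹⁰`, such that `Γ(T⁰¹)` is closed under the Lie bracket. -/
structure CRStructure (E : Type*) [NormedAddCommGroup E] [NormedSpace ℝ E]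
    (M : Type*) [TopologicalSpace M] [ChartedSpace E M] [IsManifold 𝓘(ℝ, E) ∞ M] (n : ℕ) where
  /-- the fibres of the bundle `T¹⁰` -/
  T10 : ∀ p : M, Submodule ℂ (CTangent E p)
  dim_eq : Module.finrank ℝ E = 2 * n + 1
  exists_frame : ∀ p : M, ∃ U : Set M, IsOpen U ∧ p ∈ U ∧ ∃ e : Fin n → CField E M,
    (∀ j, SmoothFieldOn (e j) U) ∧
      ∀ q ∈ U, LinearIndependent ℂ (fun j => e j q) ∧
        Submodule.span ℂ (range fun j => e j q) = T10 q
  inf_conj : ∀ p : M, T10 p ⊓ conjSubmodule (T10 p) = ⊥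
  integrable : ∀ Z W : CField E M, SmoothField Z → SmoothField W →
    (∀ p, Z p ∈ conjSubmodule (T10 p)) → (∀ p, W p ∈ conjSubmodule (T10 p)) →
      ∀ p, bracket Z W p ∈ conjSubmodule (T10 p)

namespace CRStructure

variable {E : Type*} [NormedAddCommGroup E] [NormedSpace ℝ E]
  {M : Type*} [TopologicalSpace M] [ChartedSpace E M] [IsManifold 𝓘(ℝ, E) ∞ M] {n : ℕ}

/-- The fibres of `T⁰¹`, the conjugate of `T¹⁰`. -/
def T01 (C : CRStructure E M n) (p : M) : Submodule ℂ (CTangent E p) := conjSubmodule (C.T10 p)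

/-- `L ∈ Γ(T¹⁰)`: `L` is a smooth section of `T¹⁰`. -/
def IsSection10 (C : CRStructure E M n) (L : CField E M) : Prop :=
  SmoothField L ∧ ∀ p, L p ∈ C.T10 p

/-- A trivialization of `ℂ ⊗ TM / (T¹⁰ ⊕ T⁰¹)`: a purely imaginary, nowhere vanishing smooth
`1`-form on `M` that annihilates `T¹⁰ ⊕ T⁰¹`. -/
structure Trivialization (C : CRStructure E M n) where
  /-- the `1`-form on real tangent vectors -/
  form : ∀ p : M, TangentSpace 𝓘(ℝ, E) p →L[ℝ] ℂ
  smooth : ContMDiff 𝓘(ℝ, E) (𝓘(ℝ, E).prod 𝓘(ℝ, E →L[ℝ] ℂ)) ∞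
    (fun p => Bundle.TotalSpace.mk' (E →L[ℝ] ℂ)
      (E := fun x : M => TangentSpace 𝓘(ℝ, E) x →L[ℝ] Bundle.Trivial M ℂ x) p (form p))
  imaginary : ∀ (p : M) (v : TangentSpace 𝓘(ℝ, E) p), (form p v).re = 0
  ne_zero : ∀ p : M, form p ≠ 0
  annihilates : ∀ p : M, ∀ z ∈ C.T10 p ⊔ C.T01 p, (form p).toLinearMap.liftBaseChange ℂ z = 0

namespace Trivialization

variable {C : CRStructure E M n}

/-- The complex linear extension of `η_p` to `ℂ ⊗ T_p M`. -/
def ext (η : C.Trivialization) (p : M) : CTangent E p →ₗ[ℂ] ℂ :=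
  (η.form p).toLinearMap.liftBaseChange ℂ

/-- The Levi form `λ_η(L, L') = η([L, L̄'])` at `p`, for `L, L' ∈ Γ(T¹⁰)`. Its value depends only
on `L p` and `L' p`. -/
def leviForm (η : C.Trivialization) (L L' : CField E M) (p : M) : ℂ :=
  η.ext p (bracket L (conjField L') p)

/-- The null space of the Levi form at `p`: the vectors `v ∈ T¹⁰_p` with `λ_η(v, w) = 0` for all
`w ∈ T¹⁰_p`, where `λ_η(v, w)` is computed with smooth extensions `L, L' ∈ Γ(T¹⁰)`. -/
def nullSpace (η : C.Trivialization) (p : M) : Set (CTangent E p) :=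
  {v | v ∈ C.T10 p ∧ ∀ L L' : CField E M, C.IsSection10 L → C.IsSection10 L' → L p = v →
    η.leviForm L L' p = 0}

/-- `η` is positive: `λ_η(L, L) ≥ 0` everywhere (this number is always real). -/
def IsPositive (η : C.Trivialization) : Prop :=
  ∀ (p : M) (L : CField E M), C.IsSection10 L → 0 ≤ (η.leviForm L L p).re

/-- A transversal vector field normalized with respect to `η`: a purely imaginary smooth complex
vector field `T` with `η(T) = 1`. -/
structure Transversal (η : C.Trivialization) where
  /-- the vector field -/
  field : CField E M
  smooth : SmoothField field
  imaginary : ∀ p, conjC (field p) = -field p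
  normalized : ∀ p, η.ext p (field p) = 1

end Trivialization

lemma finrank_T10 (C : CRStructure E M n) (p : M) : Module.finrank ℂ (C.T10 p) = n := by
  obtain ⟨U, -, hp, e, -, he⟩ := C.exists_frame p
  obtain ⟨h1, h2⟩ := he p hp
  rw [← h2, finrank_span_eq_card h1, Fintype.card_fin]

lemma finrank_CTangent (C : CRStructure E M n) (p : M) :
    Module.finrank ℂ (CTangent E p) = 2 * n + 1 := by
  rw [Module.finrank_baseChange]
  exact C.dim_eq

/-- The decomposition `ℂ ⊗ T_p M = T¹⁰ ⊕ (T⁰¹ ⊕ ℂ T)`. -/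
lemma isCompl (C : CRStructure E M n) {η : C.Trivialization} (T : η.Transversal) (p : M) :
    IsCompl (C.T10 p) (C.T01 p ⊔ Submodule.span ℂ {T.field p}) := by
  have hfin : FiniteDimensional ℂ (CTangent E p) :=
    FiniteDimensional.of_finrank_pos (by rw [C.finrank_CTangent p]; omega)
  have key : ∀ b ∈ C.T10 p ⊔ C.T01 p, ∀ c : ℂ, b = c • T.field p → c = 0 := by
    intro b hb c h
    have h1 : η.ext p b = 0 := η.annihilates p b hb
    rw [h, map_smul, T.normalized p] at h1
    simpa using h1
  have hd : Disjoint (C.T10 p) (C.T01 p ⊔ Submodule.span ℂ {T.field p}) := by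
    rw [Submodule.disjoint_def]
    intro z hz hz'
    obtain ⟨b, hb, w, hw, rfl⟩ := Submodule.mem_sup.1 hz'
    obtain ⟨c, rfl⟩ := Submodule.mem_span_singleton.1 hw
    have hc : c = 0 := by
      refine key (b + c • T.field p - b) ?_ c (by simp)
      exact Submodule.sub_mem _ (Submodule.mem_sup_left hz) (Submodule.mem_sup_right hb)
    subst hc
    have h0 : b ∈ C.T10 p ⊓ conjSubmodule (C.T10 p) := ⟨by simpa using hz, hb⟩
    rw [C.inf_conj p] at h0
    simpa using h0
  have hd' : Disjoint (C.T01 p) (Submodule.span ℂ {T.field p}) := by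
    rw [Submodule.disjoint_def]
    intro z hz hz'
    obtain ⟨c, rfl⟩ := Submodule.mem_span_singleton.1 hz'
    rw [key _ (Submodule.mem_sup_right hz) c rfl, zero_smul]
  have hT : T.field p ≠ 0 := by
    intro h
    have := T.normalized p
    simp [h] at this
  have hr : Module.finrank ℂ (C.T01 p ⊔ Submodule.span ℂ {T.field p} : Submodule ℂ _) = n + 1 := by
    have h := Submodule.finrank_sup_add_finrank_inf_eq (C.T01 p) (Submodule.span ℂ {T.field p})
    rw [hd'.eq_bot, finrank_bot, finrank_span_singleton hT] at h
    have h01 : Module.finrank ℂ (C.T01 p) = n :=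
      (finrank_conjSubmodule _).trans (C.finrank_T10 p)
    omega
  refine ⟨hd, codisjoint_iff.2 (Submodule.eq_top_of_disjoint _ _ ?_ hd)⟩
  rw [C.finrank_T10 p, hr, C.finrank_CTangent p]
  omega

namespace Trivialization

namespace Transversal

variable {C : CRStructure E M n} {η : C.Trivialization}

/-- The `T¹⁰`-component of a complex vector field in `ℂ ⊗ TM = T¹⁰ ⊕ T⁰¹ ⊕ ℂ T`. -/
def proj10 (T : η.Transversal) (X : CField E M) : CField E M := fun p =>
  (C.T10 p).projection (C.T01 p ⊔ Submodule.span ℂ {T.field p}) (C.isCompl T p) (X p)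

/-- The D'Angelo `1`-form `α_η = -ℒ_T η`, extended complex linearly:
`α_η(X) = η([T, X]) - T(η(X))` for a smooth complex vector field `X`. -/
def alpha (T : η.Transversal) (X : CField E M) (p : M) : ℂ :=
  η.ext p (bracket T.field X p) - deriv (T.field p) (fun q => η.ext q (X q))

/-- The D'Angelo `(1,0)`-form `ω_η`: it agrees with `α_η` on `T¹⁰` and annihilates
`T⁰¹ ⊕ ℂ T`. -/
def omega (T : η.Transversal) (X : CField E M) (p : M) : ℂ := T.alpha (T.proj10 X) p

/-- `∂̄_b ω_η (L, L̄') = L̄' ω_η(L) + ω_η([L, L̄'])` at `p`, for `L, L' ∈ Γ(T¹⁰)`. Its value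
depends only on `L p` and `L' p`. -/
def dbarOmega (T : η.Transversal) (L L' : CField E M) (p : M) : ℂ :=
  deriv (conjField L' p) (T.omega L) + T.omega (bracket L (conjField L')) p

/-- The inequality `a ∂̄_b ω_η - b ω_η ∧ ω̄_η > 0` on the null space over `S`, as quadratic forms:
`a ∂̄_b ω_η(v, v̄) - b |ω_η(v)|² > 0` for all nonzero null vectors `v` at the points of `S`, where
the forms are evaluated with smooth extensions `L ∈ Γ(T¹⁰)` of `v`. (On null vectors
`∂̄_b ω_η(v, v̄)` is real when `M` is pseudoconvex.) -/
def PosOnNull (T : η.Transversal) (a b : ℝ) (S : Set M) : Prop :=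
  ∀ p ∈ S, ∀ L : CField E M, C.IsSection10 L → L p ∈ η.nullSpace p → L p ≠ 0 →
    0 < a * (T.dbarOmega L L p).re - b * ‖T.omega L p‖ ^ 2

/-- `∂̄_b ω_η > 0` on the null space over `S`. -/
def DbarOmegaPos (T : η.Transversal) (S : Set M) : Prop := T.PosOnNull 1 0 S

/-- `∂̄_b ω_η < 0` on the null space over `S`. -/
def DbarOmegaNeg (T : η.Transversal) (S : Set M) : Prop := T.PosOnNull (-1) 0 S

end Transversal

end Trivialization

/-- `M` is pseudoconvex: it admits a positive trivialization. -/
def IsPseudoconvex (C : CRStructure E M n) : Prop := ∃ η : C.Trivialization, η.IsPositive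

/-- The Diederich–Fornæss index of `M` in the strong sense: the supremum of the `γ ∈ (0, 1)` with
`∂̄_b ω_η - γ/(1-γ) ω_η ∧ ω̄_η > 0` on the null space for some positive trivialization `η`. The
supremum of the empty set of reals is `0` in Mathlib, as wanted here. The transversal field `T` is
auxiliary: on the null space the forms do not depend on it. -/
def DFs (C : CRStructure E M n) : ℝ :=
  sSup {γ : ℝ | 0 < γ ∧ γ < 1 ∧ ∃ η : C.Trivialization, η.IsPositive ∧
    ∃ T : η.Transversal, T.PosOnNull 1 (γ / (1 - γ)) univ}

/-- The Steinness index of `M` in the strong sense: the infimum of the `γ > 1` with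
`-∂̄_b ω_η - γ/(γ-1) ω_η ∧ ω̄_η > 0` on the null space for some positive trivialization `η`,
which is `∞` if there is no such `γ`. -/
def Ss (C : CRStructure E M n) : EReal :=
  sInf ((fun γ : ℝ => (γ : EReal)) '' {γ : ℝ | 1 < γ ∧ ∃ η : C.Trivialization, η.IsPositive ∧
    ∃ T : η.Transversal, T.PosOnNull (-1) (γ / (γ - 1)) univ})

end CRStructure

/-! ### CR embeddings of complex manifolds -/

section Embedding

variable (F : Type*) [NormedAddCommGroup F] [NormedSpace ℂ F]
  {A : Type*} [TopologicalSpace A] [ChartedSpace F A]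

/-- The complex structure `J` on the real tangent space `T_a A` of a complex manifold `A` modelled
on `F`; in the chart at `a`, which identifies `T_a A` with `F`, it is multiplication by `i`. -/
def complexStructure (a : A) : TangentSpace 𝓘(ℝ, F) a →ₗ[ℝ] TangentSpace 𝓘(ℝ, F) a :=
  ((LinearMap.lsmul ℂ F Complex.I).restrictScalars ℝ : F →ₗ[ℝ] F)

/-- The holomorphic tangent space `T¹⁰_a A`: the `i`-eigenspace of `J` on `ℂ ⊗ T_a A`. -/
def holTangent (a : A) : Submodule ℂ (CTangent F a) :=
  Module.End.eigenspace ((complexStructure F a).baseChange ℂ) Complex.I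

variable {F}
variable {E : Type*} [NormedAddCommGroup E] [NormedSpace ℝ E]
  {M : Type*} [TopologicalSpace M] [ChartedSpace E M] [IsManifold 𝓘(ℝ, E) ∞ M] {n : ℕ}

/-- A CR embedding of a complex manifold into a CR manifold: a smooth embedding whose differential
maps `T¹⁰ A` into `T¹⁰ M`. -/
structure CRStructure.IsCREmbedding (C : CRStructure E M n) (ι : A → M) : Prop where
  embedding : IsSmoothEmbedding 𝓘(ℝ, F) 𝓘(ℝ, E) ∞ ι
  map_T10 : ∀ a : A, ∀ z ∈ holTangent F a,
    (mfderiv 𝓘(ℝ, F) 𝓘(ℝ, E) ι a).toLinearMap.baseChange ℂ z ∈ C.T10 (ι a)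

end Embedding

end CRGeometry

end

noncomputable section

namespace CRGeometry

open MeasureTheory

/-! ### Exterior derivative of `1`-forms on a normed space -/

section ExteriorDerivative

variable {E : Type*} [NormedAddCommGroup E] [NormedSpace ℝ E]
  {F : Type*} [NormedAddCommGroup F] [NormedSpace ℝ F]
  {N : Type*} [NormedAddCommGroup N] [NormedSpace ℝ N]

/-! The obstruction is that a compact manifold of positive dimension carries no exact symplectic
form.

A real tangent vector `v` of `A` gives the vector `dι v - i dι(Jv)` of `T¹⁰ M`. Since `η` kills both
parts of every vector of `T¹⁰`, it pulls back to zero on `A`, and so does `dη`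
(`IsCREmbedding.dForm_mfderiv`). The Levi form therefore vanishes on the diagonal at these vectors,
and for a semidefinite form this puts them in the null space (`mem_nullSpace`, the Cauchy–Schwarz
argument).

The forms `α_η` and `ω_η` are tensors, represented by the smooth `1`-forms `alphaForm` and
`omegaForm`. As `ω_η` kills `T⁰¹`, Cartan's formula gives `∂̄_b ω_η(L, L̄') = -dω_η(L, L̄')`
(`dbarOmega_eq`). At `L_p = u - iu'` this makes `Re ∂̄_b ω_η(L, L̄)` equal to `2 Im dω_η(u, u')`
(`re_dbarOmega`). If it had no zero on the vectors coming from `A`, the pullback `θ` of `Im ω_η`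
would satisfy `dθ(v, Jv) ≠ 0` for all `v ≠ 0`, so `dθ` would be an exact symplectic form on `A`.
Hence it vanishes at some nonzero null vector over `ι(A)`, which excludes both signs; subtracting a
nonnegative multiple of `|ω_η|²` does not help, so both index sets are empty.

Exact symplectic forms `dβ` are excluded without top-degree forms or orientations. The Liouville
field `X`, with `dβ(X, ·) = β`, satisfies `ℒ_X dβ = dβ`, so its divergence for the symplectic
density is the constant `dim A / 2` (`divergence_liouville`). The integral of a divergence over a
compact manifold is zero, while a positive constant has positive integral (`false_of_borel`). -/

lemma two_le_infty : (2 : WithTop ℕ∞) ≤ ∞ := by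
  show ((2 : ℕ∞) : WithTop ℕ∞) ≤ ((⊤ : ℕ∞) : WithTop ℕ∞)
  exact WithTop.coe_le_coe.2 le_top

/-- The map exchanging the arguments of a bilinear map. -/
def flipCLM : (E →L[ℝ] E →L[ℝ] N) →L[ℝ] E →L[ℝ] E →L[ℝ] N :=
  (ContinuousLinearMap.flipₗᵢ ℝ E E N).toContinuousLinearEquiv.toContinuousLinearMap

/-- The exterior derivative of a vector-valued `1`-form, as a bilinear map. -/
def extd (β : E → E →L[ℝ] N) (x : E) : E →L[ℝ] E →L[ℝ] N :=
  fderiv ℝ β x - flipCLM (fderiv ℝ β x)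

lemma extd_apply (β : E → E →L[ℝ] N) (x v w : E) :
    extd β x v w = fderiv ℝ β x v w - fderiv ℝ β x w v := rfl

lemma extd_swap (β : E → E →L[ℝ] N) (x v w : E) : extd β x v w = -extd β x w v := by
  simp [extd_apply]

@[simp] lemma extd_self (β : E → E →L[ℝ] N) (x v : E) : extd β x v v = 0 := by
  simp [extd_apply]

lemma extd_congr {β γ : E → E →L[ℝ] N} {x : E} (h : β =ᶠ[𝓝 x] γ) :
    extd β x = extd γ x := by
  rw [extd, extd, h.fderiv_eq]

lemma contDiffAt_extd {β : E → E →L[ℝ] N} {x : E} (h : ContDiffAt ℝ ∞ β x) :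
    ContDiffAt ℝ ∞ (extd β) x := by
  have h1 : ContDiffAt ℝ ∞ (fderiv ℝ β) x := h.fderiv_right (by simp)
  have h2 : ContDiff ℝ ∞ fun B : E →L[ℝ] E →L[ℝ] N => flipCLM B :=
    ContinuousLinearMap.contDiff (𝕜 := ℝ) (E := E →L[ℝ] E →L[ℝ] N) (F := E →L[ℝ] E →L[ℝ] N) flipCLM
  exact h1.sub (h2.contDiffAt.comp x h1)

/-- The exterior derivative commutes with pullback. -/
lemma extd_pullback {γ : E → E →L[ℝ] N} {β : F → F →L[ℝ] N} {f : F → E} {x : F}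
    (hβ : β =ᶠ[𝓝 x] fun y => (γ (f y)).comp (fderiv ℝ f y))
    (hγ : DifferentiableAt ℝ γ (f x)) (hf : ContDiffAt ℝ ∞ f x) (v w : F) :
    extd β x v w = extd γ (f x) (fderiv ℝ f x v) (fderiv ℝ f x w) := by
  have hf1 : DifferentiableAt ℝ f x := hf.differentiableAt (by simp)
  have hf2 : DifferentiableAt ℝ (fderiv ℝ f) x :=
    (hf.fderiv_right (m := ∞) (by simp)).differentiableAt (by simp)
  have hsym : ∀ v w, fderiv ℝ (fderiv ℝ f) x v w = fderiv ℝ (fderiv ℝ f) x w v := fun v w =>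
    (hf.isSymmSndFDerivAt (by simpa using two_le_infty)) v w
  -- The product rule leaves a term with the second derivative of `f`; it is symmetric in `v` and
  -- `w`, so antisymmetrizing removes it.
  have key : ∀ v w, fderiv ℝ β x v w = γ (f x) (fderiv ℝ (fderiv ℝ f) x v w)
      + fderiv ℝ γ (f x) (fderiv ℝ f x v) (fderiv ℝ f x w) := by
    intro v w
    have h1 : HasFDerivAt (fun y => γ (f y)) ((fderiv ℝ γ (f x)).comp (fderiv ℝ f x)) x :=
      hγ.hasFDerivAt.comp x hf1.hasFDerivAt
    rw [hβ.fderiv_eq, (h1.clm_comp hf2.hasFDerivAt).fderiv]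
    simp
  rw [extd_apply, extd_apply, key, key, hsym v w]
  abel

lemma hasFDerivAt_apply_apply {B : E → E →L[ℝ] E →L[ℝ] N} {x : E} (h : DifferentiableAt ℝ B x)
    (v w : E) : HasFDerivAt (fun y => B y v w) (((fderiv ℝ B x).flip v).flip w) x := by
  convert (h.hasFDerivAt.clm_apply (hasFDerivAt_const v x)).clm_apply
    (hasFDerivAt_const w x) using 1
  ext u
  simp

/-- The exterior derivative is closed. -/
lemma fderiv_extd_cyclic {β : E → E →L[ℝ] N} {x : E} (h : ContDiffAt ℝ ∞ β x) (u v w : E) :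
    fderiv ℝ (extd β) x u v w + fderiv ℝ (extd β) x v w u + fderiv ℝ (extd β) x w u v = 0 := by
  have h2 : DifferentiableAt ℝ (fderiv ℝ β) x :=
    (h.fderiv_right (m := ∞) (by simp)).differentiableAt (by simp)
  have hsym : ∀ v w, fderiv ℝ (fderiv ℝ β) x v w = fderiv ℝ (fderiv ℝ β) x w v := fun v w =>
    (h.isSymmSndFDerivAt (by simpa using two_le_infty)) v w
  -- The cyclic sum has six second derivatives of `β`, which cancel in pairs because the first two
  -- arguments commute.
  have key : ∀ u v w, fderiv ℝ (extd β) x u v w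
      = fderiv ℝ (fderiv ℝ β) x u v w - fderiv ℝ (fderiv ℝ β) x u w v := by
    intro u v w
    have h3 : DifferentiableAt ℝ (extd β) x := (contDiffAt_extd h).differentiableAt (by simp)
    exact congrArg (fun φ : E →L[ℝ] N => φ u) ((hasFDerivAt_apply_apply h3 v w).unique
      ((hasFDerivAt_apply_apply h2 v w).sub (hasFDerivAt_apply_apply h2 w v)))
  rw [key, key, key, hsym u v, hsym u w, hsym v w]
  abel

/-- Cartan's formula `dβ(V, W) = V β(W) - W β(V) - β([V, W])`. -/
lemma extd_eq_lieBracket {β : E → E →L[ℝ] N} {V W : E → E} {x : E} (hβ : DifferentiableAt ℝ β x)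
    (hV : DifferentiableAt ℝ V x) (hW : DifferentiableAt ℝ W x) :
    extd β x (V x) (W x) = fderiv ℝ (fun y => β y (W y)) x (V x)
      - fderiv ℝ (fun y => β y (V y)) x (W x) - β x (lieBracket ℝ V W x) := by
  rw [(hβ.hasFDerivAt.clm_apply hV.hasFDerivAt).fderiv,
    (hβ.hasFDerivAt.clm_apply hW.hasFDerivAt).fderiv]
  simp only [extd_apply, lieBracket, add_apply,
    ContinuousLinearMap.coe_comp, Function.comp_apply, ContinuousLinearMap.flip_apply, map_sub]
  abel

end ExteriorDerivative

/-! ### Liouville field and volume of an exact symplectic form -/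

section Liouville

/-- Jacobi's formula for the derivative of the determinant. -/
lemma fderiv_det_apply {ι : Type*} [Fintype ι] [DecidableEq ι] (m h : ι → ι → ℝ)
    (hm : (Matrix.of m).det ≠ 0) :
    DifferentiableAt ℝ (fun m : ι → ι → ℝ => (Matrix.of m).det) m ∧
    fderiv ℝ (fun m : ι → ι → ℝ => (Matrix.of m).det) m h
      = (Matrix.of m).det * ((Matrix.of m)⁻¹ * Matrix.of h).trace := by
  have hd : DifferentiableAt ℝ (fun m : ι → ι → ℝ => (Matrix.of m).det) m := by
    simp only [Matrix.det_apply, Matrix.of_apply]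
    fun_prop
  refine ⟨hd, ?_⟩
  have h1 : HasDerivAt (fun t : ℝ => m + t • h) h 0 := by
    simpa using ((hasDerivAt_id (0 : ℝ)).smul_const h).const_add m
  have h2 : HasDerivAt (fun t : ℝ => (Matrix.of (m + t • h)).det)
      (fderiv ℝ (fun m : ι → ι → ℝ => (Matrix.of m).det) m h) 0 := by
    have hd' : HasFDerivAt (fun m : ι → ι → ℝ => (Matrix.of m).det)
      (fderiv ℝ (fun m : ι → ι → ℝ => (Matrix.of m).det) m) (m + (0 : ℝ) • h) := by
      simpa using hd.hasFDerivAt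
    exact hd'.comp_hasDerivAt 0 h1
  set A := Matrix.of m with hA
  set B := A⁻¹ * Matrix.of h with hB
  -- The part of `det (1 + tB)` beyond the linear term, divided by `t²`; it does not contribute to
  -- the derivative at `t = 0`.
  set p := (1 + (Polynomial.X : Polynomial ℝ) • B.map ⇑Polynomial.C).det.divX.divX
  have h3 : ∀ t : ℝ, (Matrix.of (m + t • h)).det
      = A.det * (1 + B.trace * t + p.eval t * t ^ 2) := by
    intro t
    rw [← Matrix.det_one_add_smul, ← Matrix.det_mul]
    congr 1
    rw [mul_add, mul_one, Matrix.mul_smul, hB, Matrix.mul_nonsing_inv_cancel_left _ _ hm.isUnit]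
    rfl
  have h4 : HasDerivAt (fun t : ℝ => A.det * (1 + B.trace * t + p.eval t * t ^ 2))
      (A.det * B.trace) 0 := by
    have ha := ((hasDerivAt_id (0 : ℝ)).const_mul B.trace).const_add 1
    have hb := (p.hasDerivAt 0).mul ((hasDerivAt_id (0 : ℝ)).pow 2)
    simpa using (ha.add hb).const_mul A.det
  rw [funext h3] at h2
  exact h2.unique h4

variable {F : Type*} [NormedAddCommGroup F] [NormedSpace ℝ F] [FiniteDimensional ℝ F]

lemma isInvertible_of_injective (B : F →L[ℝ] F →L[ℝ] ℝ)
    (hB : ∀ v, (∀ w, B v w = 0) → v = 0) : B.IsInvertible := by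
  have hinj : Function.Injective B.toLinearMap := by
    rw [injective_iff_map_eq_zero]
    intro v hv
    exact hB v fun w => by simpa using congrArg (fun φ : F →L[ℝ] ℝ => φ w) hv
  have hdim : Module.finrank ℝ F = Module.finrank ℝ (F →L[ℝ] ℝ) := by
    rw [← (LinearMap.toContinuousLinearMap : (F →ₗ[ℝ] ℝ) ≃ₗ[ℝ] (F →L[ℝ] ℝ)).finrank_eq]
    exact (Subspace.dual_finrank_eq (K := ℝ) (V := F)).symm
  refine ⟨(LinearEquiv.ofInjectiveOfFinrankEq B.toLinearMap hinj hdim).toContinuousLinearEquiv, ?_⟩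
  ext v w
  rfl

/-- The Liouville field `X` of the exact `2`-form `dβ`, determined by `dβ(X, ·) = β`. -/
def liouville (β : F → F →L[ℝ] ℝ) (x : F) : F := (extd β x).inverse (β x)

/-- The Gram determinant of the `2`-form `dβ` in a basis. -/
def gramDet (β : F → F →L[ℝ] ℝ) (x : F) : ℝ :=
  (Matrix.of fun i j => extd β x (Module.finBasis ℝ F i) (Module.finBasis ℝ F j)).det

/-- The volume density of the exact symplectic form `dβ`. -/
def sympVol (β : F → F →L[ℝ] ℝ) (x : F) : ℝ := Real.exp (Real.log (gramDet β x) / 2)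

/-- `Real.log` is `log |·|`, so the density is `|gramDet β|^{1/2}` where the Gram determinant is
nonzero; the exponential form makes positivity unconditional. -/
lemma sympVol_pos (β : F → F →L[ℝ] ℝ) (x : F) : 0 < sympVol β x := Real.exp_pos _

omit [FiniteDimensional ℝ F] in
lemma extd_liouville {β : F → F →L[ℝ] ℝ} {x : F} (h : (extd β x).IsInvertible) :
    extd β x (liouville β x) = β x := by
  obtain ⟨e, he⟩ := h
  rw [liouville, ← he]
  simp

lemma contDiffAt_liouville {β : F → F →L[ℝ] ℝ} {x : F} (hβ : ContDiffAt ℝ ∞ β x)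
    (h : (extd β x).IsInvertible) : ContDiffAt ℝ ∞ (liouville β) x := by
  have : CompleteSpace F := FiniteDimensional.complete ℝ F
  exact (h.contDiffAt_map_inverse.comp x (contDiffAt_extd hβ)).clm_apply hβ

/-- A null vector of the Gram matrix is the coordinate vector of an element of the kernel of `extd β
x`. -/
lemma gramDet_ne_zero {β : F → F →L[ℝ] ℝ} {x : F} (h : (extd β x).IsInvertible) :
    gramDet β x ≠ 0 := by
  obtain ⟨e, he⟩ := h
  intro h0
  obtain ⟨c, hc, hc0⟩ := Matrix.exists_vecMul_eq_zero_iff.2 h0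
  apply hc
  have h1 : extd β x (∑ i, c i • Module.finBasis ℝ F i) = 0 := by
    ext w
    rw [← (Module.finBasis ℝ F).sum_repr w]
    simp only [map_sum, map_smul, sum_apply, smul_apply]
    simp only [zero_apply, smul_eq_mul, mul_zero, Finset.sum_const_zero]
    refine Finset.sum_eq_zero fun j _ => ?_
    have := congrFun hc0 j
    simp only [Matrix.vecMul, dotProduct, Matrix.of_apply, Pi.zero_apply] at this
    rw [← mul_zero ((Module.finBasis ℝ F).repr w j), ← this, Finset.mul_sum]
  rw [← he] at h1
  have h2 := e.map_eq_zero_iff.1 h1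
  funext i
  exact Fintype.linearIndependent_iff.1 (Module.finBasis ℝ F).linearIndependent c h2 i

lemma contDiffAt_gramDet {β : F → F →L[ℝ] ℝ} {x : F} (hβ : ContDiffAt ℝ ∞ β x) :
    ContDiffAt ℝ ∞ (gramDet β) x := by
  have h := contDiffAt_extd hβ
  unfold gramDet
  simp only [Matrix.det_apply, Matrix.of_apply]
  refine ContDiffAt.sum fun σ _ => ContDiffAt.const_smul _ (contDiffAt_prod fun i _ => ?_)
  exact (h.clm_apply contDiffAt_const).clm_apply contDiffAt_const

lemma contDiffAt_sympVol {β : F → F →L[ℝ] ℝ} {x : F} (hβ : ContDiffAt ℝ ∞ β x)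
    (h : (extd β x).IsInvertible) : ContDiffAt ℝ ∞ (sympVol β) x :=
  (((contDiffAt_gramDet hβ).log (gramDet_ne_zero h)).div_const 2).exp

/-- The flow of the Liouville field expands the symplectic volume at a constant rate. -/
lemma divergence_liouville {β : F → F →L[ℝ] ℝ} {x : F} (hβ : ContDiffAt ℝ ∞ β x)
    (hinv : ∀ᶠ y in 𝓝 x, (extd β y).IsInvertible) :
    fderiv ℝ (sympVol β) x (liouville β x)
        + sympVol β x * LinearMap.trace ℝ F (fderiv ℝ (liouville β) x).toLinearMap
      = (Module.finrank ℝ F / 2 : ℝ) * sympVol β x := by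
  have hx := hinv.self_of_nhds
  have hX : DifferentiableAt ℝ (liouville β) x :=
    (contDiffAt_liouville hβ hx).differentiableAt (by simp)
  have hB : DifferentiableAt ℝ (extd β) x := (contDiffAt_extd hβ).differentiableAt (by simp)
  set X := liouville β x with hXdef
  set C := fderiv ℝ (liouville β) x with hC
  -- The defining equation `dβ(X, ·) = β` differentiated in the direction `v`.
  have h1 : ∀ v w, fderiv ℝ (extd β) x v X w + extd β x (C v) w = fderiv ℝ β x v w := by
    intro v w
    have h : (fun y => extd β y (liouville β y)) =ᶠ[𝓝 x] β := by
      filter_upwards [hinv] with y hy using extd_liouville hy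
    rw [← h.fderiv_eq, (hB.hasFDerivAt.clm_apply hX.hasFDerivAt).fderiv]
    simp [add_comm, C, X]
  -- This is `ℒ_X dβ = dβ` in coordinates: closedness of `dβ` trades the derivative along `X` for
  -- the two derivatives computed in `h1`.
  have h2 : ∀ v w, fderiv ℝ (extd β) x X v w
      = extd β x v w - extd β x (C v) w - extd β x v (C w) := by
    intro v w
    have hcyc := fderiv_extd_cyclic hβ X v w
    have hsw : fderiv ℝ (extd β) x v w X = -fderiv ℝ (extd β) x v X w := by
      have e1 : ∀ a b, fderiv ℝ (extd β) x v a b = fderiv ℝ (fun y => extd β y a b) x v := by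
        intro a b
        rw [(hasFDerivAt_apply_apply hB a b).fderiv]
        rfl
      rw [e1, e1]
      simp_rw [fun y => extd_swap β y w X]
      rw [fderiv_fun_neg]
      rfl
    rw [hsw] at hcyc
    have hb : extd β x v (C w) = -extd β x (C w) v := extd_swap _ _ _ _
    have h3 := h1 v w
    have h4 := h1 w v
    rw [extd_apply β x v w]
    linarith
  set bs := Module.finBasis ℝ F with hbs
  set G : Matrix _ _ ℝ := Matrix.of fun i j => extd β x (bs i) (bs j) with hG
  have hdet : G.det ≠ 0 := gramDet_ne_zero hx
  set K : Matrix _ _ ℝ := LinearMap.toMatrix bs bs C.toLinearMap with hK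
  have hCb : ∀ i, C (bs i) = ∑ k, K k i • bs k := by
    intro i
    conv_lhs => rw [← bs.sum_repr (C (bs i))]
    simp [K, LinearMap.toMatrix_apply]
  set H : Fin (Module.finrank ℝ F) → Fin (Module.finrank ℝ F) → ℝ :=
    fun i j => fderiv ℝ (extd β) x X (bs i) (bs j) with hH
  have hHeq : Matrix.of H = G - K.transpose * G - G * K := by
    ext i j
    simp only [hH, Matrix.of_apply, h2, Matrix.sub_apply, Matrix.mul_apply, hCb, map_sum, map_smul,
      sum_apply, smul_apply, Matrix.transpose_apply,
      smul_eq_mul, hG]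
    congr 1
    exact Finset.sum_congr rfl fun k _ => mul_comm _ _
  -- By cyclicity each of the two products with `K` contributes `tr K`. The resulting `-2 tr K`,
  -- halved by the square root in `sympVol`, cancels the trace term of the divergence.
  have htr : (G⁻¹ * Matrix.of H).trace = Module.finrank ℝ F - 2 * K.trace := by
    rw [hHeq, mul_sub, mul_sub, Matrix.nonsing_inv_mul _ hdet.isUnit,
      Matrix.nonsing_inv_mul_cancel_left _ _ hdet.isUnit, Matrix.trace_sub, Matrix.trace_sub,
      Matrix.trace_mul_comm, mul_assoc, Matrix.mul_nonsing_inv _ hdet.isUnit, mul_one,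
      Matrix.trace_transpose, Matrix.trace_one, Fintype.card_fin]
    ring
  have hentry : HasFDerivAt (fun y i j => extd β y (bs i) (bs j))
      (ContinuousLinearMap.pi fun i => ContinuousLinearMap.pi fun j =>
        ((fderiv ℝ (extd β) x).flip (bs i)).flip (bs j)) x := by
    rw [hasFDerivAt_pi]
    intro i
    rw [hasFDerivAt_pi]
    intro j
    exact hasFDerivAt_apply_apply hB (bs i) (bs j)
  have hgram : fderiv ℝ (gramDet β) x X = G.det * (Module.finrank ℝ F - 2 * K.trace) := by
    obtain ⟨hd, hf⟩ := fderiv_det_apply (fun i j => extd β x (bs i) (bs j)) H hdet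
    have : HasFDerivAt (gramDet β) _ x := HasFDerivAt.comp (g := fun m : Fin _ → Fin _ → ℝ =>
      (Matrix.of m).det) x hd.hasFDerivAt hentry
    rw [this.fderiv, ContinuousLinearMap.comp_apply, ← htr, ← hf]
    rfl
  have hgd : HasFDerivAt (gramDet β) (fderiv ℝ (gramDet β) x) x :=
    ((contDiffAt_gramDet hβ).differentiableAt (by simp)).hasFDerivAt
  have hvol : HasFDerivAt (sympVol β) _ x := ((hgd.log hdet).mul_const (2⁻¹ : ℝ)).exp
  rw [hvol.fderiv, LinearMap.trace_eq_matrix_trace ℝ bs, ← hK]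
  have hg : gramDet β x = G.det := rfl
  simp only [smul_apply, hgram, smul_eq_mul, hg, sympVol, div_eq_mul_inv]
  field_simp
  ring

end Liouville

/-! ### The divergence theorem for compactly supported fields -/

section LocalDivergence

variable {F : Type*} [NormedAddCommGroup F] [NormedSpace ℝ F] [FiniteDimensional ℝ F]
  [MeasurableSpace F] [BorelSpace F]

lemma integral_fderiv_apply_eq_zero (μ : Measure F) [μ.IsAddHaarMeasure] {g : F → ℝ}
    (hg : ContDiff ℝ 1 g) (hc : HasCompactSupport g) (v : F) : ∫ x, fderiv ℝ g x v ∂μ = 0 := by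
  have h1 : Integrable (fun x => fderiv ℝ g x v) μ :=
    ((hg.continuous_fderiv (by simp)).clm_apply continuous_const).integrable_of_hasCompactSupport
      (hc.fderiv_apply ℝ v)
  -- Integration by parts against the constant function `1`.
  have h2 := integral_mul_fderiv_eq_neg_fderiv_mul_of_integrable (μ := μ) (𝕜 := ℝ)
    (f := fun _ => 1) (g := g) (v := v) (by simp) (by simpa using h1)
    (by simpa using hg.continuous.integrable_of_hasCompactSupport hc)
    (fun x _ => by fun_prop) (fun x _ => hg.differentiable (by simp) x)
  simpa using h2

lemma integral_trace_fderiv_eq_zero (μ : Measure F) [μ.IsAddHaarMeasure] {Y : F → F}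
    (hY : ContDiff ℝ 1 Y) (hc : HasCompactSupport Y) :
    ∫ x, LinearMap.trace ℝ F (fderiv ℝ Y x).toLinearMap ∂μ = 0 := by
  set bs := Module.finBasis ℝ F
  have hcoord : ∀ i, ∃ φ : F →L[ℝ] ℝ, ∀ x, φ x = bs.repr x i := fun i =>
    ⟨LinearMap.toContinuousLinearMap (bs.coord i), fun x => rfl⟩
  choose φ hφ using hcoord
  have h1 : ∀ x, LinearMap.trace ℝ F (fderiv ℝ Y x).toLinearMap
      = ∑ i, fderiv ℝ (fun y => φ i (Y y)) x (bs i) := by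
    intro x
    rw [LinearMap.trace_eq_matrix_trace ℝ bs, Matrix.trace]
    refine Finset.sum_congr rfl fun i _ => ?_
    have : HasFDerivAt (fun y => φ i (Y y)) ((φ i).comp (fderiv ℝ Y x)) x :=
      (φ i).hasFDerivAt.comp x (hY.differentiable (by simp) x).hasFDerivAt
    rw [this.fderiv]
    simp [LinearMap.toMatrix_apply, hφ]
  have hs : ∀ i, ContDiff ℝ 1 fun y => φ i (Y y) := fun i => (φ i).contDiff.comp hY
  have hcs : ∀ i, HasCompactSupport fun y => φ i (Y y) := fun i =>
    hc.comp_left (g := φ i) (map_zero _)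
  simp_rw [h1]
  rw [integral_finsetSum]
  · exact Finset.sum_eq_zero fun i _ => integral_fderiv_apply_eq_zero μ (hs i) (hcs i) _
  · intro i _
    exact (((hs i).continuous_fderiv (by simp)).clm_apply
      continuous_const).integrable_of_hasCompactSupport ((hcs i).fderiv_apply ℝ _)

/-- Integrating a compactly supported function along the Liouville field. -/
lemma integral_sympVol_mul_eq_zero (μ : Measure F) [μ.IsAddHaarMeasure] {U K : Set F}
    (hU : IsOpen U) (hK : IsCompact K) (hKU : K ⊆ U) {β : F → F →L[ℝ] ℝ} {g : F → ℝ}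
    (hβ : ∀ x ∈ U, ContDiffAt ℝ ∞ β x) (hinv : ∀ x ∈ U, (extd β x).IsInvertible)
    (hg : ∀ x ∈ U, ContDiffAt ℝ ∞ g x) (hg0 : ∀ x ∈ U, x ∉ K → g x = 0) :
    ∫ x in U, sympVol β x * ((Module.finrank ℝ F / 2 : ℝ) * g x + fderiv ℝ g x (liouville β x)) ∂μ
      = 0 := by
  -- The field `sympVol · g · X` extended by zero. It vanishes off the compact set `K ⊆ U`, so the
  -- extension is `C¹` on the whole space; its divergence is the integrand, by
  -- `divergence_liouville`.
  set Y : F → F := U.indicator fun x => (sympVol β x * g x) • liouville β x with hYdef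
  have hYin : ∀ x ∈ U, Y =ᶠ[𝓝 x] fun x => (sympVol β x * g x) • liouville β x := by
    intro x hx
    filter_upwards [hU.mem_nhds hx] with y hy using indicator_of_mem hy _
  have hY0 : ∀ x, x ∉ K → Y x = 0 := by
    intro x hx
    by_cases hxU : x ∈ U
    · rw [hYdef, indicator_of_mem hxU, hg0 x hxU hx, mul_zero, zero_smul]
    · exact indicator_of_notMem hxU _
  have hYout : ∀ x, x ∉ U → Y =ᶠ[𝓝 x] fun _ => 0 := by
    intro x hx
    filter_upwards [hK.isClosed.isOpen_compl.mem_nhds fun h => hx (hKU h)] with y hy using hY0 y hy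
  have hYs : ContDiff ℝ 1 Y := by
    rw [contDiff_iff_contDiffAt]
    intro x
    by_cases hx : x ∈ U
    · refine ContDiffAt.congr_of_eventuallyEq ?_ (hYin x hx)
      have h := ((contDiffAt_sympVol (hβ x hx) (hinv x hx)).mul (hg x hx)).smul
        (contDiffAt_liouville (hβ x hx) (hinv x hx))
      exact h.of_le (by simp)
    · exact contDiffAt_const.congr_of_eventuallyEq (hYout x hx)
  have hYc : HasCompactSupport Y := HasCompactSupport.intro hK hY0
  rw [← integral_trace_fderiv_eq_zero μ hYs hYc, ← integral_indicator hU.measurableSet]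
  congr 1
  funext x
  by_cases hx : x ∈ U
  · rw [indicator_of_mem hx, (hYin x hx).fderiv_eq]
    have hdv := ((contDiffAt_sympVol (hβ x hx) (hinv x hx)).differentiableAt
      (by simp)).hasFDerivAt
    have hdg := ((hg x hx).differentiableAt (by simp)).hasFDerivAt
    have hdX := ((contDiffAt_liouville (hβ x hx) (hinv x hx)).differentiableAt
      (by simp)).hasFDerivAt
    have hprod : HasFDerivAt (fun x => (sympVol β x * g x) • liouville β x) _ x :=
      (hdv.mul hdg).smul hdX
    rw [hprod.fderiv]
    have hdiv := divergence_liouville (hβ x hx)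
      (Filter.eventually_of_mem (hU.mem_nhds hx) hinv)
    have htr : ∀ (c : ℝ) (L : F →L[ℝ] F) (φ : F →L[ℝ] ℝ) (u : F),
        LinearMap.trace ℝ F (c • L + φ.smulRight u).toLinearMap
          = c * LinearMap.trace ℝ F L.toLinearMap + φ u := by
      intro c L φ u
      have : (c • L + φ.smulRight u).toLinearMap
        = c • L.toLinearMap + φ.toLinearMap.smulRight u := rfl
      rw [this, map_add, map_smul, LinearMap.trace_smulRight]
      rfl
    rw [htr]
    simp only [add_apply, smul_apply, smul_eq_mul, Pi.mul_apply]
    linear_combination (-g x) * hdiv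
  · rw [indicator_of_notMem hx, (hYout x hx).fderiv_eq]
    simp

end LocalDivergence

/-! ### Compact manifolds carry no exact symplectic form -/

section ExactSymplectic

variable {F : Type*} [NormedAddCommGroup F] [NormedSpace ℝ F]
  {A : Type*} [TopologicalSpace A] [ChartedSpace F A]

/-- The transition map from the chart at `a` to the chart at `a'`. -/
def transition (F : Type*) [NormedAddCommGroup F] [NormedSpace ℝ F]
    {A : Type*} [TopologicalSpace A] [ChartedSpace F A] (a a' : A) : F → F :=
  chartAt F a' ∘ (chartAt F a).symm

/-- The domain of `transition a a'`. -/
def overlap (F : Type*) [NormedAddCommGroup F] [NormedSpace ℝ F]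
    {A : Type*} [TopologicalSpace A] [ChartedSpace F A] (a a' : A) : Set F :=
  (chartAt F a).target ∩ (chartAt F a).symm ⁻¹' (chartAt F a').source

lemma isOpen_overlap (a a' : A) : IsOpen (overlap F a a') :=
  (chartAt F a).isOpen_inter_preimage_symm (chartAt F a').open_source

lemma transition_mem {a a' : A} {x : F} (hx : x ∈ overlap F a a') :
    transition F a a' x ∈ overlap F a' a := by
  refine ⟨(chartAt F a').map_source hx.2, ?_⟩
  simp only [transition, Function.comp_apply, mem_preimage]
  rw [(chartAt F a').left_inv hx.2]
  exact (chartAt F a).map_target hx.1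

lemma symm_transition {a a' : A} {x : F} (hx : x ∈ overlap F a a') :
    (chartAt F a').symm (transition F a a' x) = (chartAt F a).symm x :=
  (chartAt F a').left_inv hx.2

lemma transition_transition {a a' : A} {x : F} (hx : x ∈ overlap F a a') :
    transition F a' a (transition F a a' x) = x := by
  rw [transition, Function.comp_apply, symm_transition hx, (chartAt F a).right_inv hx.1]

lemma image_transition (a a' : A) : transition F a a' '' overlap F a a' = overlap F a' a := by
  refine Subset.antisymm (image_subset_iff.2 fun x hx => transition_mem hx) fun x hx =>
    ⟨transition F a' a x, transition_mem hx, transition_transition hx⟩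

lemma injOn_transition (a a' : A) : InjOn (transition F a a') (overlap F a a') := by
  intro x hx y hy h
  rw [← transition_transition hx, h, transition_transition hy]

lemma contDiffAt_transition [IsManifold 𝓘(ℝ, F) ∞ A] {a a' : A} {x : F}
    (hx : x ∈ overlap F a a') : ContDiffAt ℝ ∞ (transition F a a') x := by
  have h := contDiffOn_ext_coord_change (n := ∞) (I := 𝓘(ℝ, F)) a' a
  refine h.contDiffAt ?_
  refine Filter.mem_of_superset ((isOpen_overlap a a').mem_nhds hx) fun y hy => ?_
  simpa [overlap] using hy

lemma fderiv_transition_comp [IsManifold 𝓘(ℝ, F) ∞ A] {a a' : A} {x : F}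
    (hx : x ∈ overlap F a a') :
    (fderiv ℝ (transition F a' a) (transition F a a' x)).comp (fderiv ℝ (transition F a a') x)
      = ContinuousLinearMap.id ℝ F := by
  have h1 := ((contDiffAt_transition hx).differentiableAt (by simp)).hasFDerivAt
  have h2 := ((contDiffAt_transition (transition_mem hx)).differentiableAt (by simp)).hasFDerivAt
  refine (h2.comp x h1).unique ((hasFDerivAt_id x).congr_of_eventuallyEq ?_)
  filter_upwards [(isOpen_overlap a a').mem_nhds hx] with y hy using transition_transition hy

lemma fderiv_transition_surjective [IsManifold 𝓘(ℝ, F) ∞ A] {a a' : A} {x : F}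
    (hx : x ∈ overlap F a a') (v : F) : ∃ w, fderiv ℝ (transition F a a') x w = v := by
  have h := fderiv_transition_comp (transition_mem hx)
  rw [transition_transition hx] at h
  exact ⟨_, congrArg (fun φ : F →L[ℝ] F => φ v) h⟩

lemma fderiv_transition_injective [IsManifold 𝓘(ℝ, F) ∞ A] {a a' : A} {x : F}
    (hx : x ∈ overlap F a a') {v : F} (hv : fderiv ℝ (transition F a a') x v = 0) : v = 0 := by
  have h := congrArg (fun φ : F →L[ℝ] F => φ v) (fderiv_transition_comp hx)
  simpa [hv] using h.symm

/-- A smooth `1`-form on a manifold with nondegenerate exterior derivative, given by its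
representatives in the preferred charts. -/
structure IsSymplecticPotential (b : A → F → F →L[ℝ] ℝ) : Prop where
  smooth : ∀ a, ∀ x ∈ (chartAt F a).target, ContDiffAt ℝ ∞ (b a) x
  transition : ∀ a a', ∀ x ∈ overlap F a a',
    b a x = (b a' (transition F a a' x)).comp (fderiv ℝ (transition F a a') x)
  nondegenerate : ∀ (a : A) (v : F), (∀ w, extd (b a) (chartAt F a a) v w = 0) → v = 0

namespace IsSymplecticPotential

variable [IsManifold 𝓘(ℝ, F) ∞ A] {b : A → F → F →L[ℝ] ℝ} (hb : IsSymplecticPotential b)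

include hb

lemma extd_transition {a a' : A} {x : F} (hx : x ∈ overlap F a a') (v w : F) :
    extd (b a) x v w = extd (b a') (CRGeometry.transition F a a' x)
      (fderiv ℝ (CRGeometry.transition F a a') x v)
      (fderiv ℝ (CRGeometry.transition F a a') x w) := by
  refine extd_pullback ?_ ?_ (contDiffAt_transition hx) v w
  · filter_upwards [(isOpen_overlap a a').mem_nhds hx] with y hy using hb.transition a a' y hy
  · exact (hb.smooth a' _ (transition_mem hx).1).differentiableAt (by simp)

variable [FiniteDimensional ℝ F]

/-- Nondegeneracy is assumed only at the centre of each preferred chart. Any point is the centre of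
its own chart, and the transition map, whose derivative is bijective, carries the property to the
chart at `a`. -/
lemma isInvertible (a : A) {x : F} (hx : x ∈ (chartAt F a).target) :
    (extd (b a) x).IsInvertible := by
  refine isInvertible_of_injective _ fun v hv => ?_
  set q := (chartAt F a).symm x
  have hq : x ∈ overlap F a q := ⟨hx, mem_chart_source F q⟩
  refine fderiv_transition_injective hq (hb.nondegenerate q _ fun w => ?_)
  obtain ⟨w', rfl⟩ := fderiv_transition_surjective hq w
  have := hb.extd_transition hq v w'
  rw [hv w'] at this
  exact this.symm

/-- Both sides solve `dβ(X, ·) = β` in the chart at `a'`, because `β` and `dβ` transform by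
pullback; nondegeneracy makes the solution unique. -/
lemma liouville_transition {a a' : A} {x : F} (hx : x ∈ overlap F a a') :
    fderiv ℝ (CRGeometry.transition F a a') x (liouville (b a) x)
      = liouville (b a') (CRGeometry.transition F a a' x) := by
  have hx' := transition_mem hx
  obtain ⟨e, he⟩ := hb.isInvertible a' hx'.1
  have h : extd (b a') (CRGeometry.transition F a a' x)
      (fderiv ℝ (CRGeometry.transition F a a') x (liouville (b a) x))
      = b a' (CRGeometry.transition F a a' x) := by
    ext w
    obtain ⟨w', rfl⟩ := fderiv_transition_surjective hx w
    rw [← hb.extd_transition hx, extd_liouville (hb.isInvertible a hx.1), hb.transition a a' x hx]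
    rfl
  rw [← extd_liouville (hb.isInvertible a' hx'.1), ← he] at h
  exact e.injective h

/-- The Gram matrix changes by congruence, so its determinant is multiplied by the squared Jacobian
and the root by its absolute value. This is the factor of the change of variables formula, and no
orientation enters. -/
lemma sympVol_transition {a a' : A} {x : F} (hx : x ∈ overlap F a a') :
    sympVol (b a) x = |(fderiv ℝ (CRGeometry.transition F a a') x).det|
      * sympVol (b a') (CRGeometry.transition F a a' x) := by
  set D := fderiv ℝ (CRGeometry.transition F a a') x with hD
  set y := CRGeometry.transition F a a' x
  set bs := Module.finBasis ℝ F
  have hdet : D.det ≠ 0 := by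
    have h1 := congrArg (fun φ : F →L[ℝ] F => LinearMap.det φ.toLinearMap)
      (fderiv_transition_comp hx)
    intro h0
    have h2 : LinearMap.det ((fderiv ℝ (CRGeometry.transition F a' a) y).toLinearMap
      ∘ₗ D.toLinearMap) = LinearMap.det (LinearMap.id : F →ₗ[ℝ] F) := h1
    rw [LinearMap.det_comp, LinearMap.det_id] at h2
    have h3 : LinearMap.det D.toLinearMap = 0 := h0
    simp [h3] at h2
  set K := LinearMap.toMatrix bs bs D.toLinearMap with hK
  have hKdet : K.det = D.det := LinearMap.det_toMatrix bs _
  have hDb : ∀ i, D (bs i) = ∑ k, K k i • bs k := by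
    intro i
    conv_lhs => rw [← bs.sum_repr (D (bs i))]
    simp [K, LinearMap.toMatrix_apply]
  have hgram : gramDet (b a) x = D.det ^ 2 * gramDet (b a') y := by
    have : (Matrix.of fun i j => extd (b a) x (bs i) (bs j))
        = K.transpose * (Matrix.of fun i j => extd (b a') y (bs i) (bs j)) * K := by
      ext i j
      simp only [Matrix.of_apply, hb.extd_transition hx]
      rw [← hD, hDb, hDb]
      simp only [map_sum, map_smul, sum_apply, smul_apply, Matrix.mul_apply,
        Matrix.transpose_apply, Matrix.of_apply, smul_eq_mul]
      refine Finset.sum_congr rfl fun k _ => ?_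
      rw [mul_comm]
    rw [gramDet, this, Matrix.det_mul, Matrix.det_mul, Matrix.det_transpose, hKdet, gramDet]
    ring
  have hne := gramDet_ne_zero (hb.isInvertible a' (transition_mem hx).1)
  rw [sympVol, sympVol, hgram, Real.log_mul (pow_ne_zero 2 hdet) hne, Real.log_pow, add_div,
    Real.exp_add]
  congr 1
  rw [Nat.cast_ofNat, mul_div_cancel_left₀ _ (two_ne_zero), Real.exp_log_eq_abs hdet]

omit hb

/-- The derivative of a function along the Liouville field of `b`. -/
def lieDeriv (b : A → F → F →L[ℝ] ℝ) (g : A → ℝ) (q : A) : ℝ :=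
  fderiv ℝ (g ∘ (chartAt F q).symm) (chartAt F q q) (liouville (b q) (chartAt F q q))

omit [FiniteDimensional ℝ F] in
lemma contDiffAt_comp_symm {g : A → ℝ} (hg : ContMDiff 𝓘(ℝ, F) 𝓘(ℝ, ℝ) ∞ g) (a : A) {x : F}
    (hx : x ∈ (chartAt F a).target) : ContDiffAt ℝ ∞ (g ∘ (chartAt F a).symm) x := by
  have h1 : ContMDiffAt 𝓘(ℝ, F) 𝓘(ℝ, F) ∞ (chartAt F a).symm x :=
    (contMDiffOn_chart_symm (I := 𝓘(ℝ, F)) (n := ∞) (x := a)).contMDiffAt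
      ((chartAt F a).open_target.mem_nhds hx)
  exact (hg.contMDiffAt.comp x h1).contDiffAt

include hb

/-- `lieDeriv` uses a different chart at each point. Naturality of the Liouville field lets one
fixed chart compute it throughout its domain, as continuity and integration require. -/
lemma lieDeriv_symm {g : A → ℝ} (hg : ContMDiff 𝓘(ℝ, F) 𝓘(ℝ, ℝ) ∞ g) (a : A) {x : F}
    (hx : x ∈ (chartAt F a).target) : lieDeriv b g ((chartAt F a).symm x)
      = fderiv ℝ (g ∘ (chartAt F a).symm) x (liouville (b a) x) := by
  set q := (chartAt F a).symm x with hq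
  have hxq : x ∈ overlap F a q := ⟨hx, mem_chart_source F q⟩
  have hqx : chartAt F q q = CRGeometry.transition F a q x := rfl
  have h1 : (g ∘ (chartAt F a).symm) =ᶠ[𝓝 x]
      (g ∘ (chartAt F q).symm) ∘ CRGeometry.transition F a q := by
    filter_upwards [(isOpen_overlap a q).mem_nhds hxq] with y hy
    simp only [Function.comp_apply, symm_transition hy]
  rw [lieDeriv, hqx, ← hb.liouville_transition hxq, h1.fderiv_eq]
  rw [(((contDiffAt_comp_symm hg q (transition_mem hxq).1).differentiableAt
    (by simp)).hasFDerivAt.comp x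
      ((contDiffAt_transition hxq).differentiableAt (by simp)).hasFDerivAt).fderiv]
  rfl

lemma continuous_lieDeriv {g : A → ℝ} (hg : ContMDiff 𝓘(ℝ, F) 𝓘(ℝ, ℝ) ∞ g) :
    Continuous (lieDeriv b g) := by
  rw [continuous_iff_continuousAt]
  intro a
  have hx := mem_chart_target F a
  have h1 : ContinuousAt (fun x => fderiv ℝ (g ∘ (chartAt F a).symm) x (liouville (b a) x))
      (chartAt F a a) :=
    (((contDiffAt_comp_symm hg a hx).fderiv_right (m := ∞) (by simp)).clm_apply
      (contDiffAt_liouville (hb.smooth a _ hx) (hb.isInvertible a hx))).continuousAt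
  have h2 := ContinuousAt.comp h1 ((chartAt F a).continuousAt (mem_chart_source F a))
  refine h2.congr ?_
  filter_upwards [(chartAt F a).open_source.mem_nhds (mem_chart_source F a)] with q hq
  have := hb.lieDeriv_symm hg a ((chartAt F a).map_source hq)
  rw [(chartAt F a).left_inv hq] at this
  exact this.symm

omit hb

omit [IsManifold 𝓘(ℝ, F) ∞ A] [FiniteDimensional ℝ F] in
lemma lieDeriv_eq_zero {g : A → ℝ} {q : A} (hq : q ∉ tsupport g) : lieDeriv b g q = 0 := by
  have h1 : (g ∘ (chartAt F q).symm) =ᶠ[𝓝 (chartAt F q q)] fun _ => 0 := by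
    have h2 : ContinuousAt (chartAt F q).symm (chartAt F q q) :=
      (chartAt F q).continuousAt_symm (mem_chart_target F q)
    have h3 := notMem_tsupport_iff_eventuallyEq.1 hq
    have h4 : Filter.Tendsto (chartAt F q).symm (𝓝 (chartAt F q q)) (𝓝 q) := by
      have := h2.tendsto
      rwa [(chartAt F q).left_inv (mem_chart_source F q)] at this
    exact h4.eventually h3
  rw [lieDeriv, h1.fderiv_eq]
  simp

omit [IsManifold 𝓘(ℝ, F) ∞ A] [FiniteDimensional ℝ F] in
lemma tsupport_subset_of_eq_zero {f g : A → ℝ} (h : ∀ q, q ∉ tsupport g → f q = 0) :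
    tsupport f ⊆ tsupport g := by
  refine closure_minimal (fun q hq => ?_) (isClosed_tsupport g)
  by_contra hn
  exact hq (h q hn)

variable [MeasurableSpace F] [BorelSpace F]

/-- The integral of a function over the chart at `a`, for the symplectic volume of `b`. -/
def chartIntegral (b : A → F → F →L[ℝ] ℝ) (a : A) (g : A → ℝ) : ℝ :=
  ∫ x in (chartAt F a).target, sympVol (b a) x * g ((chartAt F a).symm x)
    ∂(Measure.addHaar : Measure F)

include hb

/-- For a function living on the overlap, the Jacobian of the change of variables is absorbed by the
transformation of `sympVol`. The integral of such a function is thus independent of the chart. -/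
lemma chartIntegral_eq {a a' : A} {g : A → ℝ}
    (hg : ∀ q, g q ≠ 0 → q ∈ (chartAt F a).source ∧ q ∈ (chartAt F a').source) :
    chartIntegral b a g = chartIntegral b a' g := by
  have key : ∀ a a' : A, (∀ q, g q ≠ 0 → q ∈ (chartAt F a).source ∧ q ∈ (chartAt F a').source) →
      chartIntegral b a g = ∫ x in overlap F a a', sympVol (b a) x * g ((chartAt F a).symm x)
        ∂(Measure.addHaar : Measure F) := by
    intro a a' h
    refine (setIntegral_eq_of_subset_of_forall_sdiff_eq_zero
      (chartAt F a).open_target.measurableSet inter_subset_left ?_)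
    rintro x ⟨hx, hx'⟩
    by_contra hne
    exact hx' ⟨hx, (h _ (right_ne_zero_of_mul hne)).2⟩
  rw [key a a' hg, key a' a fun q hq => (hg q hq).symm, ← image_transition a a',
    integral_image_eq_integral_abs_det_fderiv_smul (Measure.addHaar : Measure F)
      (isOpen_overlap a a').measurableSet
      (fun x hx => ((contDiffAt_transition hx).differentiableAt
        (by simp)).hasFDerivAt.hasFDerivWithinAt) (injOn_transition a a')]
  refine setIntegral_congr_fun (isOpen_overlap a a').measurableSet fun x hx => ?_
  simp only [hb.sympVol_transition hx, symm_transition hx, smul_eq_mul]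
  ring

variable [CompactSpace A]

lemma integrableOn_chart (a : A) {g : A → ℝ} (hg : Continuous g)
    (hs : tsupport g ⊆ (chartAt F a).source) :
    IntegrableOn (fun x => sympVol (b a) x * g ((chartAt F a).symm x)) (chartAt F a).target
      (Measure.addHaar : Measure F) := by
  set K := chartAt F a '' tsupport g with hK
  have hKc : IsCompact K :=
    (isClosed_tsupport g).isCompact.image_of_continuousOn ((chartAt F a).continuousOn.mono hs)
  have hKt : K ⊆ (chartAt F a).target := by
    rintro _ ⟨q, hq, rfl⟩
    exact (chartAt F a).map_source (hs hq)
  have hc : ContinuousOn (fun x => sympVol (b a) x * g ((chartAt F a).symm x))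
      (chartAt F a).target := by
    refine ContinuousOn.mul (fun x hx => ?_)
      (hg.comp_continuousOn (chartAt F a).symm.continuousOn)
    exact (contDiffAt_sympVol (hb.smooth a x hx)
      (hb.isInvertible a hx)).continuousAt.continuousWithinAt
  refine ((hc.mono hKt).integrableOn_compact hKc).of_forall_sdiff_eq_zero
    (chartAt F a).open_target.measurableSet ?_
  rintro x ⟨hx, hxK⟩
  rw [image_eq_zero_of_notMem_tsupport fun h => hxK ⟨_, h, (chartAt F a).right_inv hx⟩, mul_zero]

/-- The integrand is the divergence of `g X` for the symplectic density, and `g` has compact support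
inside the chart. -/
lemma chartIntegral_lieDeriv (a : A) {g : A → ℝ} (hg : ContMDiff 𝓘(ℝ, F) 𝓘(ℝ, ℝ) ∞ g)
    (hs : tsupport g ⊆ (chartAt F a).source) :
    chartIntegral b a (fun q => (Module.finrank ℝ F / 2 : ℝ) * g q + lieDeriv b g q) = 0 := by
  set K := chartAt F a '' tsupport g with hK
  have hKc : IsCompact K :=
    (isClosed_tsupport g).isCompact.image_of_continuousOn ((chartAt F a).continuousOn.mono hs)
  have hKt : K ⊆ (chartAt F a).target := by
    rintro _ ⟨q, hq, rfl⟩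
    exact (chartAt F a).map_source (hs hq)
  rw [← integral_sympVol_mul_eq_zero (Measure.addHaar : Measure F) (chartAt F a).open_target hKc
    hKt (hb.smooth a) (fun x hx => hb.isInvertible a hx)
    (fun x hx => contDiffAt_comp_symm hg a hx) fun x hx hxK => show g _ = 0 from
      image_eq_zero_of_notMem_tsupport fun h => hxK ⟨_, h, (chartAt F a).right_inv hx⟩]
  refine setIntegral_congr_fun (chartAt F a).open_target.measurableSet fun x hx => ?_
  simp only [hb.lieDeriv_symm hg a hx, Function.comp_apply]

variable [T2Space A] [Nonempty A] [Nontrivial F]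

/-- A compact manifold of positive dimension carries no exact symplectic form. -/
theorem false_of_borel : False := by
  obtain ⟨s, hs⟩ := isCompact_univ.elim_finite_subcover (fun a : A => (chartAt F a).source)
    (fun a => (chartAt F a).open_source) fun a _ => mem_iUnion.2 ⟨a, mem_chart_source F a⟩
  obtain ⟨f, hf⟩ := SmoothPartitionOfUnity.exists_isSubordinate 𝓘(ℝ, F) (s := (univ : Set A))
    isClosed_univ (fun a : s => (chartAt F (a : A)).source) (fun a => (chartAt F (a : A)).open_source)
    (fun q hq => by simpa using hs hq)
  have hsum : ∀ q, ∑ i, f i q = 1 := fun q => by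
    rw [← finsum_eq_sum_of_fintype]
    exact f.sum_eq_one (mem_univ q)
  set c : ℝ := Module.finrank ℝ F / 2 with hc
  -- The positivity of the dimension is what makes the divergence of the Liouville field positive.
  have hcpos : 0 < c := by
    have : 0 < Module.finrank ℝ F := Module.finrank_pos
    positivity
  have hcont : ∀ i, Continuous (f i) := fun i => (f i).contMDiff.continuous
  -- localisation of the global integral
  have hloc : ∀ (j : s) (g : A → ℝ), Continuous g → tsupport g ⊆ (chartAt F (j : A)).source →
      ∑ i : s, chartIntegral b (i : A) (fun q => f i q * g q) = chartIntegral b (j : A) g := by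
    intro j g hg hgs
    have h1 : ∀ i : s, chartIntegral b (i : A) (fun q => f i q * g q)
        = chartIntegral b (j : A) (fun q => f i q * g q) := by
      intro i
      refine hb.chartIntegral_eq fun q hq => ⟨?_, ?_⟩
      · exact hf i (subset_tsupport _ (left_ne_zero_of_mul hq))
      · exact hgs (subset_tsupport _ (right_ne_zero_of_mul hq))
    simp_rw [h1]
    have h2 : ∀ x, sympVol (b j) x * g ((chartAt F (j : A)).symm x)
        = ∑ i, sympVol (b j) x * (f i ((chartAt F (j : A)).symm x)
          * g ((chartAt F (j : A)).symm x)) := by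
      intro x
      rw [← Finset.mul_sum, ← Finset.sum_mul, hsum, one_mul]
    simp only [chartIntegral]
    simp_rw [h2]
    rw [integral_finsetSum]
    intro i _
    refine hb.integrableOn_chart (j : A) (g := fun q => f i q * g q) ((hcont i).mul hg)
      ((tsupport_subset_of_eq_zero fun q hq => ?_).trans hgs)
    rw [image_eq_zero_of_notMem_tsupport (f := g) hq, mul_zero]
  -- Here `c = ∑ j, (c f_j + X f_j)`, since `∑ j, f_j = 1` has zero derivative along `X`.
  have hlin : ∀ i : s, chartIntegral b (i : A) (fun q => f i q * c)
      = ∑ j, chartIntegral b (i : A) (fun q => f i q * (c * f j q + lieDeriv b (f j) q)) := by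
    intro i
    have h0 : ∀ q, ∑ j, lieDeriv b (f j) q = 0 := by
      intro q
      have hd : ∀ j, DifferentiableAt ℝ (f j ∘ (chartAt F q).symm) (chartAt F q q) := fun j =>
        (contDiffAt_comp_symm (f j).contMDiff q (mem_chart_target F q)).differentiableAt (by simp)
      have h1 := HasFDerivAt.fun_sum (u := Finset.univ) fun j _ => (hd j).hasFDerivAt
      have h2 : (fun x => ∑ j, (f j ∘ (chartAt F q).symm) x) = fun _ => (1 : ℝ) :=
        funext fun x => hsum _
      rw [h2] at h1
      have h3 := congrArg (fun φ : F →L[ℝ] ℝ => φ (liouville (b q) (chartAt F q q)))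
        (h1.unique (hasFDerivAt_const _ _))
      simpa [lieDeriv] using h3
    have h2 : ∀ x, sympVol (b i) x * (f i ((chartAt F (i : A)).symm x) * c)
        = ∑ j, sympVol (b i) x * (f i ((chartAt F (i : A)).symm x)
          * (c * f j ((chartAt F (i : A)).symm x)
            + lieDeriv b (f j) ((chartAt F (i : A)).symm x))) := by
      intro x
      rw [← Finset.mul_sum, ← Finset.mul_sum, Finset.sum_add_distrib, ← Finset.mul_sum, hsum, h0]
      ring
    simp only [chartIntegral]
    simp_rw [h2]
    rw [integral_finsetSum]
    intro j _
    refine hb.integrableOn_chart (i : A)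
      (g := fun q => f i q * (c * f j q + lieDeriv b (f j) q)) ((hcont i).mul ((continuous_const.mul (hcont j)).add
      (hb.continuous_lieDeriv (f j).contMDiff)))
      ((tsupport_subset_of_eq_zero fun q hq => ?_).trans (hf i))
    rw [image_eq_zero_of_notMem_tsupport hq, zero_mul]
  -- After exchanging the sums, the inner sum over `i` is the global integral of the divergence of
  -- `f_j X`. Its support lies in the chart at `j`, so `hloc` reduces it to one chart, where it
  -- vanishes.
  have htot : ∑ i : s, chartIntegral b (i : A) (fun q => f i q * c) = 0 := by
    simp_rw [hlin]
    rw [Finset.sum_comm]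
    refine Finset.sum_eq_zero fun j _ => ?_
    rw [hloc j (fun q => c * f j q + lieDeriv b (f j) q) ((continuous_const.mul (hcont j)).add
      (hb.continuous_lieDeriv (f j).contMDiff))
      ((tsupport_subset_of_eq_zero fun q hq => ?_).trans (hf j))]
    · exact hb.chartIntegral_lieDeriv (j : A) (f j).contMDiff (hf j)
    · rw [image_eq_zero_of_notMem_tsupport hq, lieDeriv_eq_zero hq, mul_zero, add_zero]
  have hnonneg : ∀ (i : s) (x : F),
      0 ≤ sympVol (b i) x * (f i ((chartAt F (i : A)).symm x) * c) := fun i x =>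
    mul_nonneg (sympVol_pos _ _).le (mul_nonneg (f.nonneg i _) hcpos.le)
  obtain ⟨q⟩ : Nonempty A := inferInstance
  obtain ⟨i, hi⟩ : ∃ i, f i q ≠ 0 := by
    by_contra! h
    simpa [h] using hsum q
  have hpos : 0 < chartIntegral b (i : A) (fun q => f i q * c) := by
    have hint := hb.integrableOn_chart (i : A) (g := fun q => f i q * c)
      ((hcont i).mul (continuous_const (y := c)))
      ((tsupport_subset_of_eq_zero fun q hq => by
        rw [image_eq_zero_of_notMem_tsupport hq, zero_mul]).trans (hf i))
    refine (setIntegral_pos_iff_support_of_nonneg_ae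
      (Filter.Eventually.of_forall (hnonneg i)) hint).2 ?_
    have ho : IsOpen ((chartAt F (i : A)).target ∩
        (chartAt F (i : A)).symm ⁻¹' {q | f i q ≠ 0}) :=
      (chartAt F (i : A)).isOpen_inter_preimage_symm (isOpen_ne_fun (hcont i) continuous_const)
    have hqs : q ∈ (chartAt F (i : A)).source := hf i (subset_tsupport _ hi)
    refine (ho.measure_pos (Measure.addHaar : Measure F) ⟨chartAt F (i : A) q,
      (chartAt F (i : A)).map_source hqs, ?_⟩).trans_le (measure_mono ?_)
    · simpa [(chartAt F (i : A)).left_inv hqs] using hi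
    · rintro x ⟨hx, hx'⟩
      exact ⟨mul_ne_zero (sympVol_pos _ _).ne' (mul_ne_zero hx' hcpos.ne'), hx⟩
  have := Finset.sum_eq_zero_iff_of_nonneg (s := Finset.univ)
    (f := fun i : s => chartIntegral b (i : A) (fun q => f i q * c))
    (fun i _ => integral_nonneg (hnonneg i))
  exact hpos.ne' (this.1 htot i (Finset.mem_univ i))

end IsSymplecticPotential

/-- A compact manifold of positive dimension carries no exact symplectic form. -/
theorem not_isSymplecticPotential [FiniteDimensional ℝ F] [Nontrivial F] [CompactSpace A]
    [T2Space A] [Nonempty A] [IsManifold 𝓘(ℝ, F) ∞ A] (b : A → F → F →L[ℝ] ℝ) :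
    ¬ IsSymplecticPotential b := fun hb => by
  borelize F
  exact hb.false_of_borel

end ExactSymplectic

/-! ### Vector fields and `1`-forms in the preferred charts -/

section Charts

variable {E : Type*} [NormedAddCommGroup E] [NormedSpace ℝ E]
  {M : Type*} [TopologicalSpace M] [ChartedSpace E M]
  {F : Type*} [NormedAddCommGroup F] [NormedSpace ℝ F]
  {N : Type*} [NormedAddCommGroup N] [NormedSpace ℝ N]

/-- The pullback of a `1`-form under a map from a normed space. -/
def pullbackForm (φ : F → M) (G : ∀ q : M, TangentSpace 𝓘(ℝ, E) q →L[ℝ] N) (y : F) : F →L[ℝ] N :=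
  (G (φ y)).comp (mfderiv 𝓘(ℝ, F) 𝓘(ℝ, E) φ y)

/-- The representative of a `1`-form in the preferred chart at `p`. -/
def formRep (p : M) (G : ∀ q : M, TangentSpace 𝓘(ℝ, E) q →L[ℝ] N) : E → E →L[ℝ] N :=
  pullbackForm (chartAt E p).symm G

/-- The representative of a vector field in the preferred chart at `p`. -/
def fieldRep (p : M) (V : ∀ q : M, TangentSpace 𝓘(ℝ, E) q) (y : E) : E :=
  mpullback 𝓘(ℝ, E) 𝓘(ℝ, E) (chartAt E p).symm V y

/-- Smoothness at a point of a vector field. -/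
def SmoothVF [IsManifold 𝓘(ℝ, E) ∞ M] (V : ∀ q : M, TangentSpace 𝓘(ℝ, E) q) (p : M) : Prop :=
  ContMDiffAt 𝓘(ℝ, E) (𝓘(ℝ, E).prod 𝓘(ℝ, E)) ∞ (fun q => (⟨q, V q⟩ : TangentBundle 𝓘(ℝ, E) M)) p

/-- Smoothness at a point of a `1`-form, in the preferred chart. -/
def SmoothForm (G : ∀ q : M, TangentSpace 𝓘(ℝ, E) q →L[ℝ] N) (p : M) : Prop :=
  ContDiffAt ℝ ∞ (formRep p G) (chartAt E p p)

/-- The exterior derivative of a `1`-form at a point, in the preferred chart. -/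
def dForm (G : ∀ q : M, TangentSpace 𝓘(ℝ, E) q →L[ℝ] N) (p : M) : E →L[ℝ] E →L[ℝ] N :=
  extd (formRep p G) (chartAt E p p)

variable [IsManifold 𝓘(ℝ, E) ∞ M]

lemma mdifferentiable_chartAt (p : M) :
    (chartAt E p).MDifferentiable 𝓘(ℝ, E) 𝓘(ℝ, E) := by
  have : IsManifold 𝓘(ℝ, E) 1 M := IsManifold.of_le (n := ∞) (by simp)
  exact mdifferentiable_chart p

lemma isInvertible_mfderiv_chartAt_symm (p : M) {y : E} (hy : y ∈ (chartAt E p).target) :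
    (mfderiv 𝓘(ℝ, E) 𝓘(ℝ, E) (chartAt E p).symm y).IsInvertible :=
  ⟨(mdifferentiable_chartAt p).symm.mfderiv hy, rfl⟩

lemma contMDiffAt_chartAt_symm (p : M) {y : E} (hy : y ∈ (chartAt E p).target) :
    ContMDiffAt 𝓘(ℝ, E) 𝓘(ℝ, E) ∞ (chartAt E p).symm y :=
  (contMDiffOn_chart_symm (I := 𝓘(ℝ, E)) (n := ∞) (x := p)).contMDiffAt
      ((chartAt E p).open_target.mem_nhds hy)

lemma contMDiffAt_chartAt (p : M) {q : M} (hq : q ∈ (chartAt E p).source) :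
    ContMDiffAt 𝓘(ℝ, E) 𝓘(ℝ, E) ∞ (chartAt E p) q :=
  (contMDiffOn_chart (I := 𝓘(ℝ, E)) (n := ∞) (x := p)).contMDiffAt
      ((chartAt E p).open_source.mem_nhds hq)

/-- The tangent space at `p` is the model space read through the chart at `p`, so this chart has
identity derivative there. Hence representatives at the centre agree with the original values. -/
lemma mfderiv_chartAt_self (p : M) (v : E) :
    (mfderiv 𝓘(ℝ, E) 𝓘(ℝ, E) (chartAt E p) p v : E) = v := by
  have : IsManifold 𝓘(ℝ, E) 1 M := IsManifold.of_le (n := ∞) (by simp)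
  have h := mfderiv_chartAt_eq_tangentCoordChange (I := 𝓘(ℝ, E)) (mem_chart_source E p)
  exact (congrArg (fun φ : E →L[ℝ] E => φ v) h).trans
    (tangentCoordChange_self (I := 𝓘(ℝ, E)) (mem_extChartAt_source p))

lemma mfderiv_chartAt_symm_self (p : M) (v : E) :
    (mfderiv 𝓘(ℝ, E) 𝓘(ℝ, E) (chartAt E p).symm (chartAt E p p) v : E) = v := by
  have h := congrArg (fun φ : E →L[ℝ] E => φ v)
    ((mdifferentiable_chartAt p).symm_comp_deriv (mem_chart_source E p))
  have h2 : (mfderiv 𝓘(ℝ, E) 𝓘(ℝ, E) (chartAt E p).symm (chartAt E p p)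
    (mfderiv 𝓘(ℝ, E) 𝓘(ℝ, E) (chartAt E p) p v) : E) = v := h
  rwa [mfderiv_chartAt_self] at h2

lemma mfderiv_chartAt_symm_fieldRep (p : M) {y : E} (hy : y ∈ (chartAt E p).target)
    (V : ∀ q : M, TangentSpace 𝓘(ℝ, E) q) :
    mfderiv 𝓘(ℝ, E) 𝓘(ℝ, E) (chartAt E p).symm y (fieldRep (E := E) p V y)
      = V ((chartAt E p).symm y) := by
  obtain ⟨e, he⟩ := isInvertible_mfderiv_chartAt_symm p hy
  show mfderiv 𝓘(ℝ, E) 𝓘(ℝ, E) (chartAt E p).symm y ((mfderiv 𝓘(ℝ, E) 𝓘(ℝ, E)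
    (chartAt E p).symm y).inverse (V ((chartAt E p).symm y))) = _
  rw [← he, ContinuousLinearMap.inverse_equiv]
  exact e.apply_symm_apply _

lemma fieldRep_self (p : M) (V : ∀ q : M, TangentSpace 𝓘(ℝ, E) q) :
    fieldRep p V (chartAt E p p) = V p := by
  have h := mfderiv_chartAt_symm_fieldRep p (mem_chart_target E p) V
  have h1 := (mfderiv_chartAt_symm_self p (fieldRep p V (chartAt E p p))).symm
  -- Forgetting that the type of the value depends on the point allows rewriting along an equality
  -- of points; the same device recurs below.
  let V' : M → E := V
  have h2 : V' ((chartAt E p).symm (chartAt E p p)) = V' p :=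
    congrArg V' ((chartAt E p).left_inv (mem_chart_source E p))
  exact h1.trans (Eq.trans h h2)

lemma formRep_fieldRep (p : M) {y : E} (hy : y ∈ (chartAt E p).target)
    (G : ∀ q : M, TangentSpace 𝓘(ℝ, E) q →L[ℝ] N) (V : ∀ q : M, TangentSpace 𝓘(ℝ, E) q) :
    formRep p G y (fieldRep p V y) = G ((chartAt E p).symm y) (V ((chartAt E p).symm y)) :=
  congrArg (G ((chartAt E p).symm y)) (mfderiv_chartAt_symm_fieldRep p hy V)

lemma formRep_self (p : M) (G : ∀ q : M, TangentSpace 𝓘(ℝ, E) q →L[ℝ] N) (v : E) :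
    formRep p G (chartAt E p p) v = G p v := by
  let G' : M → E →L[ℝ] N := G
  have h2 : G' ((chartAt E p).symm (chartAt E p p)) = G' p :=
    congrArg G' ((chartAt E p).left_inv (mem_chart_source E p))
  have h3 := congrArg (fun φ : E →L[ℝ] N => φ v) h2
  refine Eq.trans ?_ h3
  exact congrArg (G' ((chartAt E p).symm (chartAt E p p))) (mfderiv_chartAt_symm_self p v)

omit [NormedSpace ℝ E] [IsManifold 𝓘(ℝ, E) ∞ M] in
lemma eventually_mem_target (p : M) : ∀ᶠ y in 𝓝 (chartAt E p p), y ∈ (chartAt E p).target :=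
  (chartAt E p).open_target.mem_nhds (mem_chart_target E p)

variable {V W : ∀ q : M, TangentSpace 𝓘(ℝ, E) q} {G : ∀ q : M, TangentSpace 𝓘(ℝ, E) q →L[ℝ] N}
  {p : M}

lemma SmoothVF.mdifferentiableAt (hV : SmoothVF V p) :
    MDifferentiableAt 𝓘(ℝ, E) (𝓘(ℝ, E).prod 𝓘(ℝ, E))
      (fun q => (⟨q, V q⟩ : TangentBundle 𝓘(ℝ, E) M)) p :=
  ContMDiffAt.mdifferentiableAt hV (by simp)

lemma SmoothVF.contDiffAt_fieldRep [CompleteSpace E] (hV : SmoothVF V p) :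
    ContDiffAt ℝ ∞ (fieldRep p V) (chartAt E p p) := by
  have : IsManifold 𝓘(ℝ, E) (∞ + 1) M := ‹IsManifold 𝓘(ℝ, E) ∞ M›
  have hp : (chartAt E p).symm (chartAt E p p) = p := (chartAt E p).left_inv (mem_chart_source E p)
  have hV' : ContMDiffAt 𝓘(ℝ, E) (𝓘(ℝ, E).prod 𝓘(ℝ, E)) ∞
      (fun q => (⟨q, V q⟩ : TangentBundle 𝓘(ℝ, E) M)) ((chartAt E p).symm (chartAt E p p)) := by
    rw [hp]
    exact hV
  have h := ContMDiffAt.mpullback_vectorField_preimage (n := ∞) hV'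
    (contMDiffAt_chartAt_symm p (mem_chart_target E p))
    (isInvertible_mfderiv_chartAt_symm p (mem_chart_target E p)) (by simp)
  exact contMDiffAt_vectorSpace_iff_contDiffAt.1 h

lemma contMDiffAt_of_comp_symm {g : M → N} (h : ContDiffAt ℝ ∞ (g ∘ (chartAt E p).symm)
    (chartAt E p p)) : ContMDiffAt 𝓘(ℝ, E) 𝓘(ℝ, N) ∞ g p := by
  have h1 := ContMDiffAt.comp p h.contMDiffAt (contMDiffAt_chartAt p (mem_chart_source E p))
  refine h1.congr_of_eventuallyEq ?_
  filter_upwards [(chartAt E p).open_source.mem_nhds (mem_chart_source E p)] with q hq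
  simp [(chartAt E p).left_inv hq]

lemma contDiffAt_comp_chartAt_symm {g : M → N} (h : ContMDiffAt 𝓘(ℝ, E) 𝓘(ℝ, N) ∞ g p) :
    ContDiffAt ℝ ∞ (g ∘ (chartAt E p).symm) (chartAt E p p) := by
  refine (ContMDiffAt.comp (chartAt E p p) (g := g) (I' := 𝓘(ℝ, E)) ?_
    (contMDiffAt_chartAt_symm p (mem_chart_target E p))).contDiffAt
  rwa [(chartAt E p).left_inv (mem_chart_source E p)]

lemma SmoothForm.contMDiffAt_apply [CompleteSpace E] (hG : SmoothForm G p) (hV : SmoothVF V p) :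
    ContMDiffAt 𝓘(ℝ, E) 𝓘(ℝ, N) ∞ (fun q => G q (V q)) p := by
  apply contMDiffAt_of_comp_symm
  refine (ContDiffAt.clm_apply hG hV.contDiffAt_fieldRep).congr_of_eventuallyEq ?_
  filter_upwards [eventually_mem_target p] with y hy using (formRep_fieldRep p hy G V).symm

lemma mvfderiv_apply {g : M → N} (h : ContMDiffAt 𝓘(ℝ, E) 𝓘(ℝ, N) ∞ g p) (v : E) :
    mvfderiv 𝓘(ℝ, E) g p v = fderiv ℝ (g ∘ (chartAt E p).symm) (chartAt E p p) v := by
  have hp : (chartAt E p).symm (chartAt E p p) = p := (chartAt E p).left_inv (mem_chart_source E p)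
  have h1 : MDifferentiableAt 𝓘(ℝ, E) 𝓘(ℝ, N) g ((chartAt E p).symm (chartAt E p p)) := by
    rw [hp]
    exact h.mdifferentiableAt (by simp)
  have h2 := mfderiv_comp (chartAt E p p) h1
    ((contMDiffAt_chartAt_symm p (mem_chart_target E p)).mdifferentiableAt (by simp))
  rw [mfderiv_eq_fderiv] at h2
  let D : M → E →L[ℝ] N := fun q => mfderiv 𝓘(ℝ, E) 𝓘(ℝ, N) g q
  have h3 : D ((chartAt E p).symm (chartAt E p p)) = D p := congrArg D hp
  have h4 : fderiv ℝ (g ∘ (chartAt E p).symm) (chartAt E p p) v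
      = D ((chartAt E p).symm (chartAt E p p))
        (mfderiv 𝓘(ℝ, E) 𝓘(ℝ, E) (chartAt E p).symm (chartAt E p p) v) :=
    congrArg (fun φ : E →L[ℝ] N => φ v) h2
  rw [h4, h3]
  exact congrArg (D p) (mfderiv_chartAt_symm_self p v).symm

omit [IsManifold 𝓘(ℝ, E) ∞ M] in
variable (M) in
lemma isManifold_minSmoothness [IsManifold 𝓘(ℝ, E) ∞ M] (k : ℕ) :
    IsManifold 𝓘(ℝ, E) (minSmoothness ℝ k) M := by
  rw [minSmoothness_of_isRCLikeNormedField]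
  refine IsManifold.of_le (n := ∞) ?_
  show ((k : ℕ∞) : WithTop ℕ∞) ≤ ((⊤ : ℕ∞) : WithTop ℕ∞)
  exact WithTop.coe_le_coe.2 le_top

omit [ChartedSpace E M] [IsManifold 𝓘(ℝ, E) ∞ M] [TopologicalSpace M] in
lemma mlieBracket_vectorSpace (V W : ∀ x : E, TangentSpace 𝓘(ℝ, E) x) (x : E) :
    mlieBracket 𝓘(ℝ, E) V W x = lieBracket ℝ (V : E → E) (W : E → E) x :=
  (congrFun (mlieBracketWithin_univ (I := 𝓘(ℝ, E)) (V := V) (W := W)) x).symm.trans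
    ((congrFun mlieBracketWithin_eq_lieBracketWithin x).trans
      (congrFun (lieBracketWithin_univ (𝕜 := ℝ) (V := V) (W := W)) x))

lemma fieldRep_mlieBracket [CompleteSpace E] (hV : SmoothVF V p) (hW : SmoothVF W p) :
    lieBracket ℝ (fieldRep p V) (fieldRep p W) (chartAt E p p) = mlieBracket 𝓘(ℝ, E) V W p := by
  have hp : (chartAt E p).symm (chartAt E p p) = p := (chartAt E p).left_inv (mem_chart_source E p)
  have := isManifold_minSmoothness (E := E) M 3
  have hV' := hV.mdifferentiableAt
  have hW' := hW.mdifferentiableAt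
  have h := mpullback_mlieBracket (f := (chartAt E p).symm) (x₀ := chartAt E p p) (V := V) (W := W)
    (I := 𝓘(ℝ, E)) (I' := 𝓘(ℝ, E)) (n := ∞) (by rw [hp]; exact hV') (by rw [hp]; exact hW')
    (contMDiffAt_chartAt_symm p (mem_chart_target E p)) (by simpa using two_le_infty)
  rw [← fieldRep_self p (mlieBracket 𝓘(ℝ, E) V W)]
  exact (mlieBracket_vectorSpace _ _ _).symm.trans h.symm

lemma SmoothVF.mlieBracket [CompleteSpace E] (hV : SmoothVF V p) (hW : SmoothVF W p) :
    SmoothVF (mlieBracket 𝓘(ℝ, E) V W) p := by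
  have : IsManifold 𝓘(ℝ, E) (((⊤ : ℕ∞) : WithTop ℕ∞) + 1) M := ‹IsManifold 𝓘(ℝ, E) ∞ M›
  have := isManifold_minSmoothness (E := E) M 2
  have := isManifold_minSmoothness (E := E) M 3
  exact ContMDiffAt.mlieBracket_vectorField (m := ⊤) (n := ⊤) hV hW (by simp)

/-- Cartan's formula on a manifold. -/
lemma dForm_apply [CompleteSpace E] (hG : SmoothForm G p) (hV : SmoothVF V p)
    (hW : SmoothVF W p) :
    dForm G p (V p) (W p) = mvfderiv 𝓘(ℝ, E) (fun q => G q (W q)) p (V p)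
      - mvfderiv 𝓘(ℝ, E) (fun q => G q (V q)) p (W p) - G p (mlieBracket 𝓘(ℝ, E) V W p) := by
  have key := extd_eq_lieBracket (hG.differentiableAt (by simp))
    (hV.contDiffAt_fieldRep.differentiableAt (by simp))
    (hW.contDiffAt_fieldRep.differentiableAt (by simp))
  have hev : ∀ {V : ∀ q : M, TangentSpace 𝓘(ℝ, E) q}, (fun y => formRep p G y (fieldRep p V y))
      =ᶠ[𝓝 (chartAt E p p)] (fun q => G q (V q)) ∘ (chartAt E p).symm := by
    intro V
    filter_upwards [eventually_mem_target p] with y hy using formRep_fieldRep p hy G V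
  rw [hev.fderiv_eq, hev.fderiv_eq, fieldRep_mlieBracket hV hW, fieldRep_self, fieldRep_self] at key
  exact key.trans (congrArg₂ (· - ·) (congrArg₂ (· - ·)
    (mvfderiv_apply (hG.contMDiffAt_apply hW) _).symm
    (mvfderiv_apply (hG.contMDiffAt_apply hV) _).symm) (formRep_self p G _))

/-- A `1`-form is smooth if its values on a smooth frame are. -/
lemma smoothForm_of_frame [FiniteDimensional ℝ E] {κ : Type*} [Fintype κ]
    (e : κ → ∀ q : M, TangentSpace 𝓘(ℝ, E) q) (he : ∀ k, SmoothVF (e k) p)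
    (hli : LinearIndependent ℝ fun k => (e k p : E))
    (hcard : Fintype.card κ = Module.finrank ℝ E)
    (hG : ∀ k, ContMDiffAt 𝓘(ℝ, E) 𝓘(ℝ, N) ∞ (fun q => G q (e k q)) p) : SmoothForm G p := by
  have : CompleteSpace E := FiniteDimensional.complete ℝ E
  set y₀ := chartAt E p p
  -- `Φ y` sends coefficients to the corresponding combination of the frame at `y`. It is invertible
  -- at the centre, hence nearby, and the form is `Ψ ∘ Φ⁻¹` with `Ψ` its values on the frame.
  let Φ : E → (κ → ℝ) →L[ℝ] E := fun y =>
    ∑ k, (ContinuousLinearMap.proj (R := ℝ) (φ := fun _ : κ => ℝ) k).smulRight (fieldRep p (e k) y)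
  have hΦs : ContDiffAt ℝ ∞ Φ y₀ := by
    refine ContDiffAt.sum fun k _ => ?_
    exact ((ContinuousLinearMap.smulRightL ℝ (κ → ℝ) E
      (ContinuousLinearMap.proj (R := ℝ) (φ := fun _ : κ => ℝ) k)).contDiff.contDiffAt).comp y₀
        (he k).contDiffAt_fieldRep
  have hΦa : ∀ y c, Φ y c = ∑ k, c k • fieldRep p (e k) y := fun y c => by simp [Φ]
  have hinv : (Φ y₀).IsInvertible := by
    have hinj : Function.Injective (Φ y₀).toLinearMap := by
      rw [injective_iff_map_eq_zero]
      intro c hc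
      have h1 : Φ y₀ c = 0 := hc
      rw [hΦa] at h1
      have h2 : ∑ k, c k • (e k p : E) = 0 := (Finset.sum_congr rfl fun k _ =>
        congrArg (c k • ·) (fieldRep_self p (e k)).symm).trans h1
      exact funext (Fintype.linearIndependent_iff.1 hli c h2)
    refine ⟨(LinearEquiv.ofInjectiveOfFinrankEq (Φ y₀).toLinearMap hinj
      (by simpa using hcard)).toContinuousLinearEquiv, ?_⟩
    ext
    rfl
  have hinv' : ∀ᶠ y in 𝓝 y₀, (Φ y).IsInvertible := by
    have ho : IsOpen {A : (κ → ℝ) →L[ℝ] E | A.IsInvertible} := by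
      have : {A : (κ → ℝ) →L[ℝ] E | A.IsInvertible}
          = range ((↑) : ((κ → ℝ) ≃L[ℝ] E) → (κ → ℝ) →L[ℝ] E) := rfl
      rw [this]
      exact ContinuousLinearEquiv.isOpen
    exact hΦs.continuousAt.eventually (ho.mem_nhds hinv)
  have hc : ∀ k, ContDiffAt ℝ ∞ (fun y => formRep p G y (fieldRep p (e k) y)) y₀ := by
    intro k
    refine (contDiffAt_comp_chartAt_symm (hG k)).congr_of_eventuallyEq ?_
    filter_upwards [eventually_mem_target p] with y hy using formRep_fieldRep p hy G (e k)
  let Ψ : E → (κ → ℝ) →L[ℝ] N := fun y =>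
    ∑ k, (ContinuousLinearMap.proj (R := ℝ) (φ := fun _ : κ => ℝ) k).smulRight
      (formRep p G y (fieldRep p (e k) y))
  have hΨs : ContDiffAt ℝ ∞ Ψ y₀ := by
    refine ContDiffAt.sum fun k _ => ?_
    exact ((ContinuousLinearMap.smulRightL ℝ (κ → ℝ) N
      (ContinuousLinearMap.proj (R := ℝ) (φ := fun _ : κ => ℝ) k)).contDiff.contDiffAt).comp y₀
        (hc k)
  have hfin : ContDiffAt ℝ ∞ (fun y => (Ψ y).comp (Φ y).inverse) y₀ :=
    hΨs.clm_comp (hinv.contDiffAt_map_inverse.comp y₀ hΦs)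
  refine hfin.congr_of_eventuallyEq ?_
  filter_upwards [hinv'] with y hy
  have h1 : Ψ y = (formRep p G y).comp (Φ y) := by
    ext c
    simp [Ψ, hΦa]
  obtain ⟨A, hA⟩ := hy
  rw [h1, ← hA, ContinuousLinearMap.inverse_equiv]
  ext v
  simp

/-- The exterior derivative of the pullback of a `1`-form, and its smoothness. -/
lemma pullbackForm_spec {φ : F → M} {x : F}
    (hφ : ∀ᶠ y in 𝓝 x, ContMDiffAt 𝓘(ℝ, F) 𝓘(ℝ, E) ∞ φ y) (hG : SmoothForm G (φ x)) :
    ContDiffAt ℝ ∞ (pullbackForm φ G) x ∧ ∀ v w, extd (pullbackForm φ G) x v w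
      = dForm G (φ x) (mfderiv 𝓘(ℝ, F) 𝓘(ℝ, E) φ x v) (mfderiv 𝓘(ℝ, F) 𝓘(ℝ, E) φ x w) := by
  set p := φ x with hp
  set f : F → E := chartAt E p ∘ φ with hf
  have hsrc : ∀ᶠ y in 𝓝 x, φ y ∈ (chartAt E p).source :=
    hφ.self_of_nhds.continuousAt.eventually ((chartAt E p).open_source.mem_nhds
      (mem_chart_source E p))
  have hfs : ∀ᶠ y in 𝓝 x, ContDiffAt ℝ ∞ f y := by
    filter_upwards [hφ, hsrc] with y hy hys
    exact (ContMDiffAt.comp y (contMDiffAt_chartAt p hys) hy).contDiffAt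
  have hd : ∀ᶠ y in 𝓝 x, ∀ v : F, (mfderiv 𝓘(ℝ, E) 𝓘(ℝ, E) (chartAt E p) (φ y)
      (mfderiv 𝓘(ℝ, F) 𝓘(ℝ, E) φ y v) : E) = fderiv ℝ f y v := by
    filter_upwards [hφ, hsrc] with y hy hys v
    have h := mfderiv_comp y ((contMDiffAt_chartAt p hys).mdifferentiableAt (by simp))
      (hy.mdifferentiableAt (by simp))
    rw [← mfderiv_eq_fderiv]
    exact (congrArg (fun φ : F →L[ℝ] E => φ v) h).symm
  -- Read in the chart at `p`, the pullback becomes one between normed spaces, so `extd_pullback`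
  -- applies.
  have heq : pullbackForm φ G =ᶠ[𝓝 x] fun y => (formRep p G (f y)).comp (fderiv ℝ f y) := by
    filter_upwards [hsrc, hd] with y hys hdy
    ext v
    rw [ContinuousLinearMap.comp_apply, ← hdy]
    let G' : M → E →L[ℝ] N := G
    have h2 : G' ((chartAt E p).symm (f y)) = G' (φ y) :=
      congrArg G' ((chartAt E p).left_inv hys)
    have h3 := congrArg (fun A : E →L[ℝ] E => A (mfderiv 𝓘(ℝ, F) 𝓘(ℝ, E) φ y v))
      ((mdifferentiable_chartAt p).symm_comp_deriv hys)
    have h4 : (mfderiv 𝓘(ℝ, E) 𝓘(ℝ, E) (chartAt E p).symm (f y) (mfderiv 𝓘(ℝ, E) 𝓘(ℝ, E)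
      (chartAt E p) (φ y) (mfderiv 𝓘(ℝ, F) 𝓘(ℝ, E) φ y v)) : E)
        = mfderiv 𝓘(ℝ, F) 𝓘(ℝ, E) φ y v := h3
    exact ((congrArg (G' ((chartAt E p).symm (f y))) h4).trans
      (congrArg (fun A : E →L[ℝ] N => A (mfderiv 𝓘(ℝ, F) 𝓘(ℝ, E) φ y v)) h2)).symm
  have hfx := hfs.self_of_nhds
  refine ⟨ContDiffAt.congr_of_eventuallyEq (ContDiffAt.clm_comp
    (ContDiffAt.comp (g := formRep p G) (f := f) x hG hfx)
    (hfx.fderiv_right (m := ∞) (by simp))) heq, fun v w => ?_⟩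
  have hfd : ∀ v : F, fderiv ℝ f x v = mfderiv 𝓘(ℝ, F) 𝓘(ℝ, E) φ x v := fun v =>
    (hd.self_of_nhds v).symm.trans (mfderiv_chartAt_self p _)
  rw [extd_pullback heq (hG.differentiableAt (by simp)) hfx, hfd, hfd]
  rfl

end Charts

/-! ### Complex vectors, complex fields and the complex bilinear exterior derivative -/

section ComplexVectors

variable {V : Type*} [AddCommGroup V] [Module ℝ V]

lemma tmul_one_reC_add (z : ℂ ⊗[ℝ] V) :
    (1 : ℂ) ⊗ₜ[ℝ] reC z + Complex.I • ((1 : ℂ) ⊗ₜ[ℝ] imC z) = z := by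
  conv_rhs => rw [← mkC_reC_imC z]
  simp [mkC, TensorProduct.smul_tmul']

@[simp] lemma reC_mkC (x y : V) : reC (mkC x y) = x := by simp [mkC]

@[simp] lemma imC_mkC (x y : V) : imC (mkC x y) = y := by simp [mkC]

lemma eq_of_reC_imC {z w : ℂ ⊗[ℝ] V} (h1 : reC z = reC w) (h2 : imC z = imC w) : z = w := by
  rw [← mkC_reC_imC z, ← mkC_reC_imC w, h1, h2]

@[simp] lemma reC_conjC (z : ℂ ⊗[ℝ] V) : reC (conjC z) = reC z := by
  conv_lhs => rw [← mkC_reC_imC z]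
  simp [mkC]

@[simp] lemma imC_conjC (z : ℂ ⊗[ℝ] V) : imC (conjC z) = -imC z := by
  conv_lhs => rw [← mkC_reC_imC z]
  simp [mkC]

@[simp] lemma reC_smul (c : ℂ) (z : ℂ ⊗[ℝ] V) : reC (c • z) = c.re • reC z - c.im • imC z := by
  conv_lhs => rw [← mkC_reC_imC z]
  simp [mkC, TensorProduct.smul_tmul', sub_eq_add_neg]

@[simp] lemma imC_smul (c : ℂ) (z : ℂ ⊗[ℝ] V) : imC (c • z) = c.re • imC z + c.im • reC z := by
  conv_lhs => rw [← mkC_reC_imC z]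
  simp [mkC, TensorProduct.smul_tmul', add_comm]

lemma tmul_reC (z : ℂ ⊗[ℝ] V) : (1 : ℂ) ⊗ₜ[ℝ] reC z = (2⁻¹ : ℂ) • (z + conjC z) := by
  apply eq_of_reC_imC
  · simp [← two_smul ℝ, smul_smul]
  · simp

lemma tmul_imC (z : ℂ ⊗[ℝ] V) :
    (1 : ℂ) ⊗ₜ[ℝ] imC z = (-(2⁻¹ : ℂ) * Complex.I) • (z - conjC z) := by
  apply eq_of_reC_imC
  · simp [← two_smul ℝ, smul_smul]
  · simp

lemma liftBaseChange_eq (G : V →ₗ[ℝ] ℂ) (z : ℂ ⊗[ℝ] V) :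
    G.liftBaseChange ℂ z = G (reC z) + Complex.I * G (imC z) := by
  conv_lhs => rw [← mkC_reC_imC z]
  simp [mkC]

end ComplexVectors

section ComplexFields

variable {E : Type*} [NormedAddCommGroup E] [NormedSpace ℝ E]
  {M : Type*} [TopologicalSpace M] [ChartedSpace E M]
  {N : Type*} [NormedAddCommGroup N] [NormedSpace ℝ N]

/-- The complex linear extension of a complex valued `1`-form, evaluated on a complex field. -/
def evalC (G : ∀ q : M, TangentSpace 𝓘(ℝ, E) q →L[ℝ] ℂ) (Z : CField E M) (q : M) : ℂ :=
  (G q).toLinearMap.liftBaseChange ℂ (Z q)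

lemma evalC_eq (G : ∀ q : M, TangentSpace 𝓘(ℝ, E) q →L[ℝ] ℂ) (Z : CField E M) (q : M) :
    evalC G Z q = G q (reC (Z q)) + Complex.I * G q (imC (Z q)) :=
  liftBaseChange_eq _ _

/-- The complex bilinear extension of the exterior derivative of a complex valued `1`-form. -/
def dFormC (G : ∀ q : M, TangentSpace 𝓘(ℝ, E) q →L[ℝ] ℂ) (p : M) (z w : CTangent E p) : ℂ :=
  dForm G p (reC z) (reC w) - dForm G p (imC z) (imC w)
    + Complex.I * (dForm G p (reC z) (imC w) + dForm G p (imC z) (reC w))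

variable [IsManifold 𝓘(ℝ, E) ∞ M]

/-- Smoothness at a point of a complex vector field. -/
def SmoothFieldAt (Z : CField E M) (p : M) : Prop :=
  SmoothVF (fun q => reC (Z q)) p ∧ SmoothVF (fun q => imC (Z q)) p

variable {Z W : CField E M} {V V' : ∀ q : M, TangentSpace 𝓘(ℝ, E) q} {p : M}

lemma SmoothFieldOn.smoothFieldAt {U : Set M} (h : SmoothFieldOn Z U) (hU : IsOpen U)
    (hp : p ∈ U) : SmoothFieldAt Z p :=
  ⟨h.1.contMDiffAt (hU.mem_nhds hp), h.2.contMDiffAt (hU.mem_nhds hp)⟩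

lemma SmoothField.smoothFieldAt (h : SmoothField Z) (p : M) : SmoothFieldAt Z p :=
  SmoothFieldOn.smoothFieldAt h isOpen_univ (mem_univ p)

lemma SmoothVF.add (hV : SmoothVF V p) (hV' : SmoothVF V' p) :
    SmoothVF (fun q => V q + V' q) p := ContMDiffAt.add_section hV hV'

lemma SmoothVF.sub (hV : SmoothVF V p) (hV' : SmoothVF V' p) :
    SmoothVF (fun q => V q - V' q) p := ContMDiffAt.sub_section hV hV'

lemma SmoothVF.neg (hV : SmoothVF V p) : SmoothVF (fun q => -V q) p := ContMDiffAt.neg_section hV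

lemma SmoothVF.smul {f : M → ℝ} (hf : ContMDiffAt 𝓘(ℝ, E) 𝓘(ℝ, ℝ) ∞ f p) (hV : SmoothVF V p) :
    SmoothVF (fun q => f q • V q) p := ContMDiffAt.smul_section hf hV

lemma SmoothVF.congr (hV : SmoothVF V p) (h : ∀ᶠ q in 𝓝 p, V' q = V q) : SmoothVF V' p := by
  refine ContMDiffAt.congr_of_eventuallyEq hV ?_
  filter_upwards [h] with q hq
  rw [hq]

lemma SmoothVF.sum {κ : Type*} (s : Finset κ) {V : κ → ∀ q : M, TangentSpace 𝓘(ℝ, E) q}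
    (h : ∀ k ∈ s, SmoothVF (V k) p) : SmoothVF (fun q => ∑ k ∈ s, V k q) p :=
  ContMDiffAt.sum_section h

lemma SmoothFieldAt.conj (h : SmoothFieldAt Z p) : SmoothFieldAt (conjField Z) p := by
  refine ⟨?_, ?_⟩
  · simpa only [conjField, reC_conjC] using h.1
  · simpa only [conjField, imC_conjC] using h.2.neg

lemma SmoothFieldAt.smul {f : M → ℂ} (hf : ContMDiffAt 𝓘(ℝ, E) 𝓘(ℝ, ℂ) ∞ f p)
    (h : SmoothFieldAt Z p) : SmoothFieldAt (fun q => f q • Z q) p := by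
  have hre : ContMDiffAt 𝓘(ℝ, E) 𝓘(ℝ, ℝ) ∞ (fun q => (f q).re) p :=
    ContMDiffAt.comp p (I' := 𝓘(ℝ, ℂ)) Complex.reCLM.contDiff.contDiffAt.contMDiffAt hf
  have him : ContMDiffAt 𝓘(ℝ, E) 𝓘(ℝ, ℝ) ∞ (fun q => (f q).im) p :=
    ContMDiffAt.comp p (I' := 𝓘(ℝ, ℂ)) Complex.imCLM.contDiff.contDiffAt.contMDiffAt hf
  refine ⟨?_, ?_⟩
  · simp only [reC_smul]
    exact (h.1.smul hre).sub (h.2.smul him)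
  · simp only [imC_smul]
    exact (h.2.smul hre).add (h.1.smul him)

lemma SmoothFieldAt.sum {κ : Type*} (s : Finset κ) {Z : κ → CField E M}
    (h : ∀ k ∈ s, SmoothFieldAt (Z k) p) : SmoothFieldAt (fun q => ∑ k ∈ s, Z k q) p := by
  refine ⟨?_, ?_⟩
  · simp only [map_sum]
    exact SmoothVF.sum s fun k hk => (h k hk).1
  · simp only [map_sum]
    exact SmoothVF.sum s fun k hk => (h k hk).2

lemma SmoothFieldAt.congr (h : SmoothFieldAt Z p) (hW : ∀ᶠ q in 𝓝 p, W q = Z q) :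
    SmoothFieldAt W p :=
  ⟨h.1.congr (hW.mono fun q hq => by rw [hq]), h.2.congr (hW.mono fun q hq => by rw [hq])⟩

lemma SmoothFieldAt.bracket [CompleteSpace E] (hZ : SmoothFieldAt Z p) (hW : SmoothFieldAt W p) :
    SmoothFieldAt (bracket Z W) p := by
  refine ⟨?_, ?_⟩
  · simp only [CRGeometry.bracket, reC_mkC]
    exact (hZ.1.mlieBracket hW.1).sub (hZ.2.mlieBracket hW.2)
  · simp only [CRGeometry.bracket, imC_mkC]
    exact (hZ.1.mlieBracket hW.2).add (hZ.2.mlieBracket hW.1)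

omit [IsManifold 𝓘(ℝ, E) ∞ M] in
lemma deriv_eq (z : CTangent E p) (f : M → ℂ) : deriv z f
    = mvfderiv 𝓘(ℝ, E) f p (reC z) + Complex.I * mvfderiv 𝓘(ℝ, E) f p (imC z) :=
  liftBaseChange_eq _ _

lemma mvfderiv_eq_zero {f : M → N} {c : N} (h : ∀ᶠ q in 𝓝 p, f q = c) (v : E) :
    mvfderiv 𝓘(ℝ, E) f p v = 0 := by
  have h1 : f =ᶠ[𝓝 p] fun _ => c := h
  rw [mvfderiv_apply ((contMDiffAt_const (c := c)).congr_of_eventuallyEq h1)]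
  have h2 : (f ∘ (chartAt E p).symm) =ᶠ[𝓝 (chartAt E p p)] fun _ => c := by
    have h3 : Filter.Tendsto (chartAt E p).symm (𝓝 (chartAt E p p)) (𝓝 p) := by
      have := ((chartAt E p).continuousAt_symm (mem_chart_target E p)).tendsto
      rwa [(chartAt E p).left_inv (mem_chart_source E p)] at this
    exact h3.eventually h
  rw [h2.fderiv_eq]
  simp

lemma deriv_eq_zero {f : M → ℂ} {c : ℂ} (h : ∀ᶠ q in 𝓝 p, f q = c) (z : CTangent E p) :
    deriv z f = 0 := by
  rw [deriv_eq]
  have h1 := mvfderiv_eq_zero (E := E) h (reC z)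
  have h2 := mvfderiv_eq_zero (E := E) h (imC z)
  exact (congrArg₂ (fun a b => a + Complex.I * b) h1 h2).trans (by simp)

/-- Cartan's formula for complex fields. -/
lemma dFormC_apply [CompleteSpace E] {G : ∀ q : M, TangentSpace 𝓘(ℝ, E) q →L[ℝ] ℂ}
    (hG : SmoothForm G p) (hZ : SmoothFieldAt Z p) (hW : SmoothFieldAt W p) :
    dFormC G p (Z p) (W p) = deriv (Z p) (evalC G W) - deriv (W p) (evalC G Z)
      - evalC G (bracket Z W) p := by
  have hadd : ∀ {Z : CField E M}, SmoothFieldAt Z p → ∀ v : TangentSpace 𝓘(ℝ, E) p,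
      mvfderiv 𝓘(ℝ, E) (evalC G Z) p v = mvfderiv 𝓘(ℝ, E) (fun q => G q (reC (Z q))) p v
        + Complex.I * mvfderiv 𝓘(ℝ, E) (fun q => G q (imC (Z q))) p v := by
    intro Z hZ v
    have h1 := hG.contMDiffAt_apply hZ.1
    have h2 := hG.contMDiffAt_apply hZ.2
    have h3 : ContMDiffAt 𝓘(ℝ, E) 𝓘(ℝ, ℂ) ∞ (evalC G Z) p := by
      apply contMDiffAt_of_comp_symm
      rw [funext (evalC_eq G Z)]
      exact (contDiffAt_comp_chartAt_symm h1).add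
        (contDiffAt_const.mul (contDiffAt_comp_chartAt_symm h2))
    have h1' := (contDiffAt_comp_chartAt_symm h1).differentiableAt (by simp)
    have h2' := (contDiffAt_comp_chartAt_symm h2).differentiableAt (by simp)
    have h4 : HasFDerivAt (evalC G Z ∘ (chartAt E p).symm) _ (chartAt E p p) :=
      (h1'.hasFDerivAt.add (h2'.hasFDerivAt.const_mul Complex.I)).congr_of_eventuallyEq
        (Filter.Eventually.of_forall fun y => evalC_eq G Z _)
    refine (mvfderiv_apply h3 v).trans ?_
    rw [h4.fderiv]
    exact (congrArg₂ (fun a b => a + Complex.I * b) (mvfderiv_apply h1 v)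
      (mvfderiv_apply h2 v)).symm
  have d11 := dForm_apply hG hZ.1 hW.1
  have d22 := dForm_apply hG hZ.2 hW.2
  have d12 := dForm_apply hG hZ.1 hW.2
  have d21 := dForm_apply hG hZ.2 hW.1
  rw [dFormC, deriv_eq, deriv_eq, hadd hW, hadd hW, hadd hZ, hadd hZ, evalC_eq]
  simp only [bracket, reC_mkC, imC_mkC, map_add, map_sub]
  refine (congrArg₂ (· + ·) (congrArg₂ (· - ·) d11 d22)
    (congrArg (Complex.I * ·) (congrArg₂ (· + ·) d12 d21))).trans ?_
  linear_combination (- mvfderiv 𝓘(ℝ, E) (fun q => G q (imC (W q))) p (imC (Z p))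
    + mvfderiv 𝓘(ℝ, E) (fun q => G q (imC (Z q))) p (imC (W p))) * Complex.I_mul_I

omit [IsManifold 𝓘(ℝ, E) ∞ M] in
/-- The exterior derivative commutes with linear maps on the values. -/
lemma dForm_clm_comp {G : ∀ q : M, TangentSpace 𝓘(ℝ, E) q →L[ℝ] ℂ} (hG : SmoothForm G p)
    (Λ : ℂ →L[ℝ] N) :
    SmoothForm (fun q => Λ.comp (G q)) p ∧
      ∀ v w, dForm (fun q => Λ.comp (G q)) p v w = Λ (dForm G p v w) := by
  have h : formRep p (fun q => Λ.comp (G q)) = fun y => Λ.comp (formRep p G y) := rfl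
  have hd : HasFDerivAt (fun y => Λ.comp (formRep p G y))
      ((ContinuousLinearMap.compL ℝ E ℂ N Λ).comp (fderiv ℝ (formRep p G) (chartAt E p p)))
      (chartAt E p p) :=
    (ContinuousLinearMap.compL ℝ E ℂ N Λ).hasFDerivAt.comp _
      (hG.differentiableAt (by simp)).hasFDerivAt
  refine ⟨?_, fun v w => ?_⟩
  · rw [SmoothForm, h]
    exact contDiffAt_const.clm_comp hG
  · rw [dForm, h, extd_apply, hd.fderiv, dForm, extd_apply, map_sub]
    rfl

end ComplexFields

lemma reC_eq_zero_of_conjC {V : Type*} [AddCommGroup V] [Module ℝ V] {z : ℂ ⊗[ℝ] V}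
    (h : conjC z = -z) : reC z = 0 := by
  have h1 := congrArg reC h
  rw [reC_conjC, map_neg] at h1
  have h2 : (2 : ℝ) • reC z = 0 := by
    rw [two_smul]
    nth_rewrite 1 [h1]
    exact neg_add_cancel _
  exact (smul_eq_zero.1 h2).resolve_left two_ne_zero

/-! ### The forms `η`, `α_η`, `ω_η` as smooth tensors, and their exterior derivatives. -/

namespace CRStructure

variable {E : Type*} [NormedAddCommGroup E] [NormedSpace ℝ E]
  {M : Type*} [TopologicalSpace M] [ChartedSpace E M] [IsManifold 𝓘(ℝ, E) ∞ M] {n : ℕ}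
  {C : CRStructure E M n}

instance finiteDimensional_tangentSpace [FiniteDimensional ℝ E] (p : M) :
    FiniteDimensional ℝ (TangentSpace 𝓘(ℝ, E) p) := inferInstanceAs (FiniteDimensional ℝ E)

instance t2Space_tangentSpace (p : M) : T2Space (TangentSpace 𝓘(ℝ, E) p) :=
  inferInstanceAs (T2Space E)

lemma conjC_mem_T01 {p : M} {z : CTangent E p} (hz : z ∈ C.T10 p) : conjC z ∈ C.T01 p := by
  simpa [T01] using hz

namespace Trivialization

variable {η : C.Trivialization}

/-- `η` kills both `z` and `z̄`, hence their sum and difference. -/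
lemma form_reC_imC (η : C.Trivialization) {p : M} {z : CTangent E p} (hz : z ∈ C.T10 p) :
    η.form p (reC z) = 0 ∧ η.form p (imC z) = 0 := by
  have h1 := η.annihilates p z (Submodule.mem_sup_left hz)
  have h2 := η.annihilates p (conjC z) (Submodule.mem_sup_right (conjC_mem_T01 hz))
  rw [liftBaseChange_eq] at h1 h2
  simp only [reC_conjC, imC_conjC, ContinuousLinearMap.coe_coe, map_neg] at h1 h2
  have h3 : η.form p (reC z) = 0 := by linear_combination (h1 + h2) / 2
  refine ⟨h3, ?_⟩
  rw [h3, zero_add] at h1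
  exact (mul_eq_zero.1 h1).resolve_left Complex.I_ne_zero

namespace Transversal

variable (T : η.Transversal)

lemma reC_field (p : M) : reC (T.field p) = 0 := reC_eq_zero_of_conjC (T.imaginary p)

lemma form_imC_field (p : M) : η.form p (imC (T.field p)) = -Complex.I := by
  have h := T.normalized p
  rw [Trivialization.ext, liftBaseChange_eq, T.reC_field, map_zero, zero_add] at h
  have h' : Complex.I * η.form p (imC (T.field p)) = 1 := h
  linear_combination (-Complex.I) * h' + η.form p (imC (T.field p)) * Complex.I_mul_I

lemma tmul_imC_field (p : M) :
    (1 : ℂ) ⊗ₜ[ℝ] imC (T.field p) = (-Complex.I) • T.field p := by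
  apply eq_of_reC_imC <;> simp [T.reC_field]

/-- A local frame of the real tangent bundle, built from a local frame of `T¹⁰` and `T`. -/
def frame (e : Fin n → CField E M) : Fin n ⊕ Fin n ⊕ Unit → ∀ q : M, TangentSpace 𝓘(ℝ, E) q
  | .inl j => fun q => reC (e j q)
  | .inr (.inl j) => fun q => imC (e j q)
  | .inr (.inr _) => fun q => imC (T.field q)

/-- Applying `η` to a relation removes the `T`-coefficient. The rest is the real part of some `z ∈
T¹⁰`; if it is zero then `z̄ = -z`, so `z ∈ T¹⁰ ∩ T⁰¹ = 0`. -/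
lemma linearIndependent_frame {e : Fin n → CField E M} {q : M}
    (hli : LinearIndependent ℂ fun j => e j q) (he : ∀ j, e j q ∈ C.T10 q) :
    LinearIndependent ℝ fun k => T.frame e k q := by
  rw [Fintype.linearIndependent_iff]
  intro c hc
  simp only [Fintype.sum_sum_type, frame, Finset.univ_unique, Finset.sum_singleton] at hc
  set a : Fin n → ℝ := fun j => c (.inl j)
  set b : Fin n → ℝ := fun j => c (.inr (.inl j))
  set t : ℝ := c (.inr (.inr default))
  have ht : t = 0 := by
    have h := congrArg (η.form q) hc
    simp only [map_add, map_sum, map_smul, (η.form_reC_imC (he _)).1, (η.form_reC_imC (he _)).2,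
      T.form_imC_field, smul_zero, Finset.sum_const_zero, zero_add, map_zero] at h
    have := congrArg Complex.im h
    simpa using this
  -- The coefficients come from `Re ((a - ib) e) = a Re e + b Im e`.
  set z : CTangent E q := ∑ j, ((a j : ℂ) - b j * Complex.I) • e j q with hz
  have hz10 : z ∈ C.T10 q := Submodule.sum_mem _ fun j _ => Submodule.smul_mem _ _ (he j)
  have hre : reC z = 0 := by
    rw [ht, zero_smul, add_zero, ← Finset.sum_add_distrib] at hc
    rw [← hc, hz, map_sum]
    refine Finset.sum_congr rfl fun j _ => ?_
    simp [a, b]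
  have hconj : conjC z = -z := by
    apply eq_of_reC_imC <;> simp [hre]
  have hz0 : z = 0 := by
    have h1 : z ∈ C.T10 q ⊓ conjSubmodule (C.T10 q) :=
      ⟨hz10, show conjC z ∈ C.T10 q by rw [hconj]; exact Submodule.neg_mem _ hz10⟩
    rwa [C.inf_conj q, Submodule.mem_bot] at h1
  have hcoef := Fintype.linearIndependent_iff.1 hli _ hz0
  have hab : ∀ j, a j = 0 ∧ b j = 0 := by
    intro j
    have h1 := congrArg Complex.re (hcoef j)
    have h2 := congrArg Complex.im (hcoef j)
    simp at h1 h2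
    exact ⟨h1, h2⟩
  rintro (j | j | j)
  · exact (hab j).1
  · exact (hab j).2
  · exact ht

/-- Smoothness of a `1`-form is tested on a frame of `T¹⁰` and on `T`. -/
lemma smoothForm_of_frame [FiniteDimensional ℝ E] {N : Type*} [NormedAddCommGroup N]
    [NormedSpace ℝ N] {U : Set M} (hU : IsOpen U) {p : M} (hp : p ∈ U) {e : Fin n → CField E M}
    (hes : ∀ j, SmoothFieldOn (e j) U) (hli : LinearIndependent ℂ fun j => e j p)
    (he : ∀ j, e j p ∈ C.T10 p) {G : ∀ q : M, TangentSpace 𝓘(ℝ, E) q →L[ℝ] N}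
    (hre : ∀ j, ContMDiffAt 𝓘(ℝ, E) 𝓘(ℝ, N) ∞ (fun q => G q (reC (e j q))) p)
    (him : ∀ j, ContMDiffAt 𝓘(ℝ, E) 𝓘(ℝ, N) ∞ (fun q => G q (imC (e j q))) p)
    (hT : ContMDiffAt 𝓘(ℝ, E) 𝓘(ℝ, N) ∞ (fun q => G q (imC (T.field q))) p) :
    SmoothForm G p := by
  refine CRGeometry.smoothForm_of_frame (T.frame e) ?_ (T.linearIndependent_frame hli he) ?_ ?_
  · rintro (j | j | j)
    · exact (SmoothFieldOn.smoothFieldAt (hes j) hU hp).1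
    · exact (SmoothFieldOn.smoothFieldAt (hes j) hU hp).2
    · exact (T.smooth.smoothFieldAt p).2
  · simp [C.dim_eq]
    omega
  · rintro (j | j | j)
    · exact hre j
    · exact him j
    · exact hT

include T in
-- On the frame `Re e_j`, `Im e_j`, `Im T` the form `η` takes the constant values `0`, `0` and `-i`.
lemma smoothForm_form [FiniteDimensional ℝ E] (p : M) : SmoothForm η.form p := by
  obtain ⟨U, hU, hp, e, hes, hq⟩ := C.exists_frame p
  have hmem : ∀ q ∈ U, ∀ j, e j q ∈ C.T10 q := fun q hqU j => by
    rw [← (hq q hqU).2]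
    exact Submodule.subset_span ⟨j, rfl⟩
  have hc : ∀ {f : M → ℂ} {c : ℂ}, (∀ q ∈ U, f q = c) → ContMDiffAt 𝓘(ℝ, E) 𝓘(ℝ, ℂ) ∞ f p := by
    intro f c h
    refine (contMDiffAt_const (c := c)).congr_of_eventuallyEq ?_
    filter_upwards [hU.mem_nhds hp] with q hqU using h q hqU
  exact T.smoothForm_of_frame hU hp hes (hq p hp).1 (hmem p hp)
    (fun j => hc fun q hqU => (η.form_reC_imC (hmem q hqU j)).1)
    (fun j => hc fun q hqU => (η.form_reC_imC (hmem q hqU j)).2)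
    (hc fun q _ => T.form_imC_field q)

/-- The form `α_η` on real tangent vectors, as a tensor. -/
def alphaForm (p : M) : TangentSpace 𝓘(ℝ, E) p →L[ℝ] ℂ :=
  (-Complex.I) • (dForm η.form p (imC (T.field p)) : E →L[ℝ] ℂ)

lemma alphaForm_apply (p : M) (v : TangentSpace 𝓘(ℝ, E) p) :
    T.alphaForm p v = -Complex.I * dForm η.form p (imC (T.field p)) v := rfl

/-- Since `η(T) = 1` is constant, Cartan's formula gives `α_η = -dη(T, ·)`, which is tensorial. As
`T = i Im T`, this is `-i dη(Im T, ·)`. -/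
lemma alpha_eq [FiniteDimensional ℝ E] {X : CField E M} {p : M} (hX : SmoothFieldAt X p) :
    T.alpha X p = evalC T.alphaForm X p := by
  have : CompleteSpace E := FiniteDimensional.complete ℝ E
  have h := dFormC_apply (T.smoothForm_form p) (T.smooth.smoothFieldAt p) hX
  have h1 : deriv (X p) (evalC η.form T.field) = 0 :=
    deriv_eq_zero (c := 1) (Filter.Eventually.of_forall fun q => T.normalized q) _
  have h2 : dFormC η.form p (T.field p) (X p) = -evalC T.alphaForm X p := by
    rw [dFormC, evalC_eq, T.alphaForm_apply, T.alphaForm_apply]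
    have h3 : ∀ v, dForm η.form p (reC (T.field p)) v = 0 := fun v => by
      have h4 := congrArg (fun u : E => dForm η.form p u v) (T.reC_field p)
      refine h4.trans ?_
      change dForm η.form p (0 : E) v = 0
      rw [map_zero]
      rfl
    have h6 : ∀ x y : ℂ, 0 - y + Complex.I * (0 + x)
        = -(-Complex.I * x + Complex.I * (-Complex.I * y)) := fun x y => by
      linear_combination (-y) * Complex.I_mul_I
    rw [h3, h3]
    exact h6 _ _
  have h5 : T.alpha X p = evalC η.form (bracket T.field X) p
    - deriv (T.field p) (evalC η.form X) := rfl
  rw [h5]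
  rw [h1, h2] at h
  linear_combination h

/-- The projection to `T¹⁰` along `T⁰¹ ⊕ ℂ T` at a point. -/
def projAt (p : M) : CTangent E p →ₗ[ℂ] CTangent E p :=
  (C.T10 p).projection (C.T01 p ⊔ Submodule.span ℂ {T.field p}) (C.isCompl T p)

lemma projAt_mem (p : M) (z : CTangent E p) : T.projAt p z ∈ C.T10 p :=
  Submodule.projection_apply_mem _ z

lemma projAt_of_mem_T10 {p : M} {z : CTangent E p} (hz : z ∈ C.T10 p) : T.projAt p z = z :=
  Submodule.projection_apply_of_mem_left _ hz

lemma projAt_conjC {p : M} {z : CTangent E p} (hz : z ∈ C.T10 p) : T.projAt p (conjC z) = 0 :=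
  Submodule.projection_apply_of_mem_right _ (Submodule.mem_sup_left (conjC_mem_T01 hz))

lemma projAt_field (p : M) : T.projAt p (T.field p) = 0 :=
  Submodule.projection_apply_of_mem_right _
    (Submodule.mem_sup_right (Submodule.mem_span_singleton_self _))

lemma projAt_tmul_reC {p : M} {z : CTangent E p} (hz : z ∈ C.T10 p) :
    T.projAt p ((1 : ℂ) ⊗ₜ[ℝ] reC z) = (2⁻¹ : ℂ) • z := by
  rw [tmul_reC, map_smul, map_add, T.projAt_of_mem_T10 hz, T.projAt_conjC hz, add_zero]

lemma projAt_tmul_imC {p : M} {z : CTangent E p} (hz : z ∈ C.T10 p) :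
    T.projAt p ((1 : ℂ) ⊗ₜ[ℝ] imC z) = (-(2⁻¹ : ℂ) * Complex.I) • z := by
  rw [tmul_imC, map_smul, map_sub, T.projAt_of_mem_T10 hz, T.projAt_conjC hz, sub_zero]

lemma projAt_tmul_imC_field (p : M) : T.projAt p ((1 : ℂ) ⊗ₜ[ℝ] imC (T.field p)) = 0 := by
  rw [tmul_imC_field, map_smul, projAt_field, smul_zero]

lemma proj10_eq (X : CField E M) (p : M) : T.proj10 X p = T.projAt p (X p) := rfl

/-- The `T¹⁰`-component of a smooth field is smooth. -/
lemma smoothFieldAt_proj10 [FiniteDimensional ℝ E] {X : CField E M} {p : M}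
    (hX : SmoothFieldAt X p) : SmoothFieldAt (T.proj10 X) p := by
  have : CompleteSpace E := FiniteDimensional.complete ℝ E
  obtain ⟨U, hU, hp, e, hes, hq⟩ := C.exists_frame p
  have hmem : ∀ q ∈ U, ∀ j, e j q ∈ C.T10 q := fun q hqU j => by
    rw [← (hq q hqU).2]
    exact Submodule.subset_span ⟨j, rfl⟩
  -- `K q u` lists the coefficients, in the frame `e`, of the `T¹⁰`-component of the real vector
  -- `u`. As a vector-valued `1`-form it has constant values on the real frame, hence is smooth; off
  -- `U` it is irrelevant.
  have hK : ∀ q, ∃ K : TangentSpace 𝓘(ℝ, E) q →L[ℝ] (Fin n → ℂ), q ∈ U →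
      ∀ u, T.projAt q ((1 : ℂ) ⊗ₜ[ℝ] u) = ∑ j, K u j • e j q := by
    intro q
    by_cases hqU : q ∈ U
    · let B := Module.Basis.span (hq q hqU).1
      have hmem' : ∀ z, T.projAt q z ∈ Submodule.span ℂ (range fun j => e j q) := fun z => by
        rw [(hq q hqU).2]
        exact T.projAt_mem q z
      let P : CTangent E q →ₗ[ℂ] (Fin n → ℂ) := B.equivFun.toLinearMap ∘ₗ
        LinearMap.codRestrict _ (T.projAt q) hmem'
      let K : TangentSpace 𝓘(ℝ, E) q →ₗ[ℝ] (Fin n → ℂ) :=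
        P.restrictScalars ℝ ∘ₗ TensorProduct.mk ℝ ℂ (TangentSpace 𝓘(ℝ, E) q) 1
      refine ⟨LinearMap.toContinuousLinearMap K, fun _ u => ?_⟩
      have h1 := congrArg Subtype.val (B.sum_equivFun
        ⟨T.projAt q ((1 : ℂ) ⊗ₜ[ℝ] u), hmem' _⟩)
      refine h1.symm.trans ?_
      rw [Submodule.coe_sum]
      refine Finset.sum_congr rfl fun j _ => ?_
      rw [Submodule.coe_smul, Module.Basis.span_apply]
      rfl
    · exact ⟨0, fun h => absurd h hqU⟩
  choose K hK using hK
  have huniq : ∀ q ∈ U, ∀ (u : TangentSpace 𝓘(ℝ, E) q) (c : Fin n → ℂ),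
      T.projAt q ((1 : ℂ) ⊗ₜ[ℝ] u) = ∑ j, c j • e j q → K q u = c := by
    intro q hqU u c h
    rw [hK q hqU, ← sub_eq_zero, ← Finset.sum_sub_distrib] at h
    simp_rw [← sub_smul] at h
    funext j
    exact sub_eq_zero.1 (Fintype.linearIndependent_iff.1 (hq q hqU).1 _ h j)
  have hc : ∀ {f : M → Fin n → ℂ} {c : Fin n → ℂ}, (∀ q ∈ U, f q = c) →
      ContMDiffAt 𝓘(ℝ, E) 𝓘(ℝ, Fin n → ℂ) ∞ f p := by
    intro f c h
    refine (contMDiffAt_const (c := c)).congr_of_eventuallyEq ?_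
    filter_upwards [hU.mem_nhds hp] with q hqU using h q hqU
  have hKs : SmoothForm K p := by
    refine T.smoothForm_of_frame hU hp hes (hq p hp).1 (hmem p hp)
      (fun j => hc (c := Pi.single j 2⁻¹) fun q hqU => huniq q hqU _ _ ?_)
      (fun j => hc (c := Pi.single j (-(2⁻¹ : ℂ) * Complex.I)) fun q hqU => huniq q hqU _ _ ?_)
      (hc (c := 0) fun q hqU => huniq q hqU _ _ ?_)
    · rw [T.projAt_tmul_reC (hmem q hqU j)]
      simp [Pi.single_apply, ite_smul]
    · rw [T.projAt_tmul_imC (hmem q hqU j)]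
      simp only [Pi.single_apply, ite_smul, zero_smul]
      simp
    · rw [T.projAt_tmul_imC_field]
      simp
  have hcoef : ∀ {V : ∀ q : M, TangentSpace 𝓘(ℝ, E) q}, SmoothVF V p → ∀ j,
      ContDiffAt ℝ ∞ ((fun q => K q (V q) j) ∘ (chartAt E p).symm) (chartAt E p p) :=
    fun hV j => contDiffAt_pi.1 (contDiffAt_comp_chartAt_symm (hKs.contMDiffAt_apply hV)) j
  have hfin : SmoothFieldAt (fun q => ∑ j, (K q (reC (X q)) j
      + Complex.I * K q (imC (X q)) j) • e j q) p := by
    refine SmoothFieldAt.sum _ fun j _ => SmoothFieldAt.smul ?_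
      (SmoothFieldOn.smoothFieldAt (hes j) hU hp)
    apply contMDiffAt_of_comp_symm
    exact (hcoef hX.1 j).add (contDiffAt_const.mul (hcoef hX.2 j))
  refine hfin.congr ?_
  filter_upwards [hU.mem_nhds hp] with q hqU
  rw [proj10_eq]
  conv_lhs => rw [← tmul_one_reC_add (X q)]
  rw [map_add, map_smul, hK q hqU, hK q hqU, Finset.smul_sum, ← Finset.sum_add_distrib]
  refine Finset.sum_congr rfl fun j _ => ?_
  rw [add_smul, smul_smul]

/-- The form `ω_η` on real tangent vectors, as a tensor. -/
def omegaForm [FiniteDimensional ℝ E] (p : M) : TangentSpace 𝓘(ℝ, E) p →L[ℝ] ℂ :=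
  LinearMap.toContinuousLinearMap
    (((((T.alphaForm p).toLinearMap.liftBaseChange ℂ).comp (T.projAt p)).restrictScalars ℝ).comp
      (TensorProduct.mk ℝ ℂ (TangentSpace 𝓘(ℝ, E) p) 1))

variable [FiniteDimensional ℝ E]

lemma omegaForm_apply (p : M) (v : TangentSpace 𝓘(ℝ, E) p) : T.omegaForm p v
    = (T.alphaForm p).toLinearMap.liftBaseChange ℂ (T.projAt p ((1 : ℂ) ⊗ₜ[ℝ] v)) := rfl

lemma liftBaseChange_omegaForm (p : M) (z : CTangent E p) :
    (T.omegaForm p).toLinearMap.liftBaseChange ℂ z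
      = (T.alphaForm p).toLinearMap.liftBaseChange ℂ (T.projAt p z) := by
  have h : T.projAt p z = T.projAt p ((1 : ℂ) ⊗ₜ[ℝ] reC z)
      + Complex.I • T.projAt p ((1 : ℂ) ⊗ₜ[ℝ] imC z) := by
    rw [← map_smul, ← map_add, tmul_one_reC_add]
  rw [liftBaseChange_eq, h, map_add, map_smul]
  rfl

lemma omega_eq {X : CField E M} {p : M} (hX : SmoothFieldAt X p) :
    T.omega X p = evalC T.omegaForm X p := by
  rw [omega, T.alpha_eq (T.smoothFieldAt_proj10 hX), evalC, evalC, T.liftBaseChange_omegaForm]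
  rfl

/-- On the real frame `ω_η` takes the values `α_η(e_j)/2`, `-i α_η(e_j)/2` and `0`. Moreover
`α_η(e_j) = η([T, e_j])` is smooth, because `η(e_j)` vanishes on `U`. -/
lemma smoothForm_omegaForm (p : M) : SmoothForm T.omegaForm p := by
  have : CompleteSpace E := FiniteDimensional.complete ℝ E
  obtain ⟨U, hU, hp, e, hes, hq⟩ := C.exists_frame p
  have hmem : ∀ q ∈ U, ∀ j, e j q ∈ C.T10 q := fun q hqU j => by
    rw [← (hq q hqU).2]
    exact Submodule.subset_span ⟨j, rfl⟩
  have hform := T.smoothForm_form p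
  have halpha : ∀ j, ∀ q ∈ U, evalC T.alphaForm (e j) q
      = evalC η.form (bracket T.field (e j)) q := by
    intro j q hqU
    rw [← T.alpha_eq (SmoothFieldOn.smoothFieldAt (hes j) hU hqU)]
    have h0 : deriv (T.field q) (evalC η.form (e j)) = 0 := by
      refine deriv_eq_zero (c := 0) ?_ _
      filter_upwards [hU.mem_nhds hqU] with q' hq'
      exact η.annihilates q' _ (Submodule.mem_sup_left (hmem q' hq' j))
    have h5 : T.alpha (e j) q = evalC η.form (bracket T.field (e j)) q
      - deriv (T.field q) (evalC η.form (e j)) := rfl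
    rw [h5, h0, sub_zero]
  have hs : ∀ (j : Fin n) (c : ℂ), ContMDiffAt 𝓘(ℝ, E) 𝓘(ℝ, ℂ) ∞
      (fun q => c * evalC η.form (bracket T.field (e j)) q) p := by
    intro j c
    have hb := (T.smooth.smoothFieldAt p).bracket (SmoothFieldOn.smoothFieldAt (hes j) hU hp)
    apply contMDiffAt_of_comp_symm
    rw [funext (evalC_eq η.form (bracket T.field (e j)))]
    exact contDiffAt_const.mul ((contDiffAt_comp_chartAt_symm (hform.contMDiffAt_apply hb.1)).add
      (contDiffAt_const.mul (contDiffAt_comp_chartAt_symm (hform.contMDiffAt_apply hb.2))))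
  refine T.smoothForm_of_frame hU hp hes (hq p hp).1 (hmem p hp)
    (fun j => (hs j 2⁻¹).congr_of_eventuallyEq ?_)
    (fun j => (hs j (-(2⁻¹ : ℂ) * Complex.I)).congr_of_eventuallyEq ?_)
    ((contMDiffAt_const (c := (0 : ℂ))).congr_of_eventuallyEq ?_)
  · filter_upwards [hU.mem_nhds hp] with q hqU
    rw [omegaForm_apply, T.projAt_tmul_reC (hmem q hqU j), map_smul, ← halpha j q hqU]
    rfl
  · filter_upwards [hU.mem_nhds hp] with q hqU
    rw [omegaForm_apply, T.projAt_tmul_imC (hmem q hqU j), map_smul, ← halpha j q hqU]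
    rfl
  · filter_upwards with q
    rw [omegaForm_apply, T.projAt_tmul_imC_field, map_zero]

/-- `∂̄_b ω_η (L, L̄') = -dω_η (L, L̄')`. -/
lemma dbarOmega_eq {L L' : CField E M} (hL : C.IsSection10 L) (hL' : C.IsSection10 L') (p : M) :
    T.dbarOmega L L' p = -dFormC T.omegaForm p (L p) (conjC (L' p)) := by
  have : CompleteSpace E := FiniteDimensional.complete ℝ E
  have hL1 := hL.1.smoothFieldAt
  have hL2 := fun q => (hL'.1.smoothFieldAt q).conj
  have h := dFormC_apply (T.smoothForm_omegaForm p) (hL1 p) (hL2 p)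
  -- The one term of Cartan's formula absent from the definition of `∂̄_b ω_η`; it vanishes because
  -- `ω_η` kills `T⁰¹`.
  have h1 : deriv (L p) (evalC T.omegaForm (conjField L')) = 0 := by
    refine deriv_eq_zero (c := 0) (Filter.Eventually.of_forall fun q => ?_) _
    rw [evalC, T.liftBaseChange_omegaForm]
    simp only [conjField]
    rw [T.projAt_conjC (hL'.2 q), map_zero]
  have h2 : T.omega L = evalC T.omegaForm L := funext fun q => T.omega_eq (hL1 q)
  rw [dbarOmega, h2, T.omega_eq ((hL1 p).bracket (hL2 p))]
  rw [h1] at h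
  have h3 : dFormC T.omegaForm p (L p) (conjC (L' p))
    = dFormC T.omegaForm p (L p) (conjField L' p) := rfl
  rw [h3, h]
  ring

end Transversal

/-- `λ_η(L, L') = -dη(L, L̄')`. -/
lemma leviForm_eq [FiniteDimensional ℝ E] (T : η.Transversal) {L L' : CField E M}
    (hL : C.IsSection10 L) (hL' : C.IsSection10 L') (p : M) :
    η.leviForm L L' p = -dFormC η.form p (L p) (conjC (L' p)) := by
  have : CompleteSpace E := FiniteDimensional.complete ℝ E
  have hL1 := hL.1.smoothFieldAt
  have hL2 := fun q => (hL'.1.smoothFieldAt q).conj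
  have h := dFormC_apply (T.smoothForm_form p) (hL1 p) (hL2 p)
  have h1 : deriv (L p) (evalC η.form (conjField L')) = 0 :=
    deriv_eq_zero (c := 0) (Filter.Eventually.of_forall fun q =>
      η.annihilates q _ (Submodule.mem_sup_right (conjC_mem_T01 (hL'.2 q)))) _
  have h2 : deriv (conjField L' p) (evalC η.form L) = 0 :=
    deriv_eq_zero (c := 0) (Filter.Eventually.of_forall fun q =>
      η.annihilates q _ (Submodule.mem_sup_left (hL.2 q))) _
  rw [h1, h2] at h
  have h3 : dFormC η.form p (L p) (conjC (L' p))
    = dFormC η.form p (L p) (conjField L' p) := rfl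
  rw [h3, h]
  rw [sub_zero, zero_sub, neg_neg]
  rfl

end Trivialization

/-- Every vector of `T¹⁰` extends to a smooth section. -/
lemma exists_section [FiniteDimensional ℝ E] [T2Space M] {p : M} {z : CTangent E p}
    (hz : z ∈ C.T10 p) : ∃ L : CField E M, C.IsSection10 L ∧ L p = z := by
  obtain ⟨U, hU, hp, e, hes, hq⟩ := C.exists_frame p
  have hmem : ∀ q ∈ U, ∀ j, e j q ∈ C.T10 q := fun q hqU j => by
    rw [← (hq q hqU).2]
    exact Submodule.subset_span ⟨j, rfl⟩
  rw [← (hq p hp).2, Submodule.mem_span_range_iff_exists_fun] at hz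
  obtain ⟨c, hc⟩ := hz
  -- A bump function supported in `U` cuts off the constant-coefficient combination of the local
  -- frame.
  obtain ⟨f, -, hf⟩ := (SmoothBumpFunction.nhds_basis_tsupport (I := 𝓘(ℝ, E)) p).mem_iff.1
    (hU.mem_nhds hp)
  have hZ : ∀ q ∈ U, SmoothFieldAt (fun q => ∑ j, c j • e j q) q := fun q hqU =>
    SmoothFieldAt.sum _ fun j _ => SmoothFieldAt.smul (f := fun _ => c j) contMDiffAt_const
      (SmoothFieldOn.smoothFieldAt (hes j) hU hqU)
  refine ⟨fun q => ((f q : ℝ) : ℂ) • ∑ j, c j • e j q, ⟨⟨?_, ?_⟩, fun q => ?_⟩, ?_⟩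
  · have h1 : ContMDiff 𝓘(ℝ, E) (𝓘(ℝ, E).prod 𝓘(ℝ, E)) ∞ (fun q =>
        (⟨q, (f q) • reC (∑ j, c j • e j q)⟩ : TangentBundle 𝓘(ℝ, E) M)) :=
      ContMDiffOn.smul_section_of_tsupport f.contMDiff.contMDiffOn hU hf
        fun q hqU => (hZ q hqU).1.contMDiffWithinAt
    rw [contMDiffOn_univ]
    refine h1.congr fun q => ?_
    rw [reC_smul, Complex.ofReal_re, Complex.ofReal_im, zero_smul, sub_zero]
  · have h1 : ContMDiff 𝓘(ℝ, E) (𝓘(ℝ, E).prod 𝓘(ℝ, E)) ∞ (fun q =>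
        (⟨q, (f q) • imC (∑ j, c j • e j q)⟩ : TangentBundle 𝓘(ℝ, E) M)) :=
      ContMDiffOn.smul_section_of_tsupport f.contMDiff.contMDiffOn hU hf
        fun q hqU => (hZ q hqU).2.contMDiffWithinAt
    rw [contMDiffOn_univ]
    refine h1.congr fun q => ?_
    rw [imC_smul, Complex.ofReal_re, Complex.ofReal_im, zero_smul, add_zero]
  · by_cases hqU : q ∈ U
    · exact Submodule.smul_mem _ _ (Submodule.sum_mem _ fun j _ =>
        Submodule.smul_mem _ _ (hmem q hqU j))
    · have h0 : f q = 0 := image_eq_zero_of_notMem_tsupport fun h => hqU (hf h)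
      simp [h0]
  · simp [hc]

end CRStructure

/-! ### Real expressions for `∂̄_b ω_η` and the Levi form; null vectors. -/

namespace CRStructure

variable {E : Type*} [NormedAddCommGroup E] [NormedSpace ℝ E] [FiniteDimensional ℝ E]
  {M : Type*} [TopologicalSpace M] [ChartedSpace E M] [IsManifold 𝓘(ℝ, E) ∞ M] {n : ℕ}
  {C : CRStructure E M n}

omit [FiniteDimensional ℝ E] [IsManifold 𝓘(ℝ, E) ∞ M] in
lemma dFormC_mkC_conjC {G : ∀ q : M, TangentSpace 𝓘(ℝ, E) q →L[ℝ] ℂ} {p : M}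
    (x y x' y' : TangentSpace 𝓘(ℝ, E) p) : dFormC G p (mkC x y) (conjC (mkC x' y'))
      = dForm G p x x' - dForm G p y (-y' : E)
        + Complex.I * (dForm G p x (-y' : E) + dForm G p y x') := by
  have h : ∀ a b a' b' c d c' d' : TangentSpace 𝓘(ℝ, E) p, a = c → b = d → a' = c' → b' = d' →
      dForm G p a a' - dForm G p b b' + Complex.I * (dForm G p a b' + dForm G p b a')
        = dForm G p c c' - dForm G p d d' + Complex.I * (dForm G p c d' + dForm G p d c') := by
    rintro a b a' b' _ _ _ _ rfl rfl rfl rfl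
    rfl
  have h3 : reC (conjC (mkC x' y')) = x' := by simp
  have h4 : imC (conjC (mkC x' y')) = -y' := by simp
  exact h _ _ _ _ _ _ _ _ (reC_mkC x y) (imC_mkC x y) h3 h4

namespace Trivialization

variable {η : C.Trivialization}

/-- For `z = u - iu'` skew-symmetry gives `dω(z, z̄) = 2i dω(u, u')`. The real part of `∂̄_b ω_η`
thus sees only the exact real form `d(Im ω_η)`. -/
lemma Transversal.re_dbarOmega (T : η.Transversal) {L : CField E M} (hL : C.IsSection10 L)
    {p : M} {u u' : TangentSpace 𝓘(ℝ, E) p} (h : L p = mkC u (-u')) :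
    (T.dbarOmega L L p).re = 2 * (dForm T.omegaForm p u u').im := by
  have key : ∀ (B : E →L[ℝ] E →L[ℝ] ℂ), (∀ v, B v v = 0) → (∀ v w, B v w = -B w v) →
      ∀ u u' : E, -(B u u - B (-u') (- -u') + Complex.I * (B u (- -u') + B (-u') u))
        = -(2 * Complex.I * B u u') := fun B h0 h1 u u' => by
    rw [neg_neg, map_neg, neg_apply, neg_apply, h0, h0, h1 u' u]
    ring
  have h2 := key (dForm T.omegaForm p) (fun v => extd_self _ _ v)
    (fun v w => (extd_swap _ _ v w)) u u'
  have h3 : T.dbarOmega L L p = -(2 * Complex.I * dForm T.omegaForm p u u') := by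
    rw [T.dbarOmega_eq hL hL, h, dFormC_mkC_conjC]
    exact h2
  rw [h3]
  simp

/-- The Levi form in terms of the real two-form `Im dη`. -/
lemma leviForm_re_im (T : η.Transversal) {L L' : CField E M} (hL : C.IsSection10 L)
    (hL' : C.IsSection10 L') {p : M} {x y x' y' : TangentSpace 𝓘(ℝ, E) p}
    (h : L p = mkC x y) (h' : L' p = mkC x' y') :
    (η.leviForm L L' p).re = (dForm η.form p y x').im - (dForm η.form p x y').im ∧
    (η.leviForm L L' p).im = -((dForm η.form p x x').im + (dForm η.form p y y').im) := by
  -- `η` is purely imaginary, hence so is `dη`.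
  have hre : ∀ v w : E, (dForm η.form p v w).re = 0 := fun v w => by
    have h1 := (dForm_clm_comp (T.smoothForm_form p) Complex.reCLM).2 v w
    have h2 : (fun q => Complex.reCLM.comp (η.form q)) = fun q =>
        (0 : TangentSpace 𝓘(ℝ, E) q →L[ℝ] ℝ) := by
      funext q
      ext v
      exact η.imaginary q v
    rw [h2] at h1
    refine h1.symm.trans ?_
    have h3 : (formRep p fun q => (0 : TangentSpace 𝓘(ℝ, E) q →L[ℝ] ℝ)) = fun _ => 0 := rfl
    simp [dForm, extd_apply, h3]
  have key : ∀ (B : E →L[ℝ] E →L[ℝ] ℂ), (∀ v w, (B v w).re = 0) → ∀ x y x' y' : E,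
      (-(B x x' - B y (-y') + Complex.I * (B x (-y') + B y x'))).re = (B y x').im - (B x y').im ∧
      (-(B x x' - B y (-y') + Complex.I * (B x (-y') + B y x'))).im
        = -((B x x').im + (B y y').im) := fun B h0 x y x' y' => by
    rw [map_neg, map_neg]
    constructor
    · simp [h0]; ring
    · simp [h0]
  have h3 := key (dForm η.form p) hre x y x' y'
  rw [leviForm_eq T hL hL', h, h', dFormC_mkC_conjC]
  exact h3

lemma eq_zero_of_quadratic_nonpos {B c : ℝ} (h : ∀ t : ℝ, t * B + t ^ 2 * c ≤ 0) : B = 0 := by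
  have hc : c ≤ 0 := by
    have h1 := h 1
    have h2 := h (-1)
    linarith
  -- For this `t` one has `B = (1 - c) t`, so the quadratic expression equals `t²`; and `1 - c > 0`.
  have h1 := h (B / (1 - c))
  have h2 : B / (1 - c) * B + (B / (1 - c)) ^ 2 * c = (B / (1 - c)) ^ 2 := by
    have : 1 - c ≠ 0 := by linarith
    field_simp
    ring
  rw [h2] at h1
  have h3 := pow_eq_zero_iff two_ne_zero |>.1 (le_antisymm h1 (sq_nonneg _))
  exact (div_eq_zero_iff.1 h3).resolve_right (by linarith)

/-- A vector of `T¹⁰` on which a positive Levi form vanishes is a null vector. -/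
lemma mem_nullSpace [T2Space M] (hη : η.IsPositive) (T : η.Transversal) {p : M}
    {u u' : TangentSpace 𝓘(ℝ, E) p} (hz : mkC u (-u') ∈ C.T10 p)
    (h0 : dForm η.form p u u' = 0) : mkC u (-u') ∈ η.nullSpace p := by
  set B : E →L[ℝ] E →L[ℝ] ℝ := dForm (fun q => Complex.imCLM.comp (η.form q)) p with hB
  have hBd : ∀ v w : E, (dForm η.form p v w).im = B v w := fun v w =>
    ((dForm_clm_comp (T.smoothForm_form p) Complex.imCLM).2 v w).symm
  have hswap : ∀ v w, B v w = -B w v := fun v w => extd_swap _ _ v w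
  -- At `x + iy` the Levi form is `-2 B(x, y)`, so positivity of `η` is the sign condition `B(x, y)
  -- ≤ 0`.
  have hneg : ∀ x y : TangentSpace 𝓘(ℝ, E) p, mkC x y ∈ C.T10 p → B x y ≤ 0 := by
    intro x y hxy
    obtain ⟨L, hL, hLp⟩ := C.exists_section hxy
    have h1 := hη p L hL
    have h2 : (η.leviForm L L p).re = B y x - B x y :=
      ((leviForm_re_im T hL hL hLp hLp).1).trans (congrArg₂ _ (hBd y x) (hBd x y))
    rw [h2, hswap y x] at h1
    linarith
  have hBu : B u u' = 0 := by
    have h1 := congrArg Complex.im h0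
    exact (hBd u u').symm.trans h1
  -- Along `z + tw` with `w = x + iy`, the sign condition bounds a quadratic in `t` without constant
  -- term; its linear coefficient must vanish.
  have hcross : ∀ x y : TangentSpace 𝓘(ℝ, E) p, mkC x y ∈ C.T10 p → B u y + B u' x = 0 := by
    intro x y hxy
    refine eq_zero_of_quadratic_nonpos (c := B x y) fun t => ?_
    have h1 : mkC (u + t • x) (-u' + t • y) ∈ C.T10 p := by
      have h2 := (C.T10 p).add_mem hz ((C.T10 p).smul_mem (t : ℂ) hxy)
      convert h2 using 1
      apply eq_of_reC_imC <;> simp [-Complex.coe_smul]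
    have h3 := hneg _ _ h1
    have h4 : ∀ a a' b b' : E, B (a + t • b) (-a' + t • b')
        = -B a a' + t * (B a b' + B a' b) + t ^ 2 * B b b' := fun a a' b b' => by
      simp only [map_add, map_neg, map_smul, add_apply,
        smul_apply, smul_eq_mul]
      rw [hswap b a']
      ring
    have h5 := h4 u u' x y
    rw [hBu] at h5
    have h6 := h5.symm.le.trans h3
    linarith
  refine ⟨hz, fun L L' hL hL' hLp => ?_⟩
  have hxy : mkC (reC (L' p)) (imC (L' p)) ∈ C.T10 p := by
    rw [mkC_reC_imC]
    exact hL'.2 p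
  -- `hcross` at `L'` gives the real part of `λ_η(L, L')`, and at `iL'` the imaginary part.
  have hxy' : mkC (-imC (L' p)) (reC (L' p)) ∈ C.T10 p := by
    have h2 := (C.T10 p).smul_mem Complex.I hxy
    convert h2 using 1
    apply eq_of_reC_imC <;> simp
  obtain ⟨h1, h2⟩ := leviForm_re_im T hL hL' hLp (mkC_reC_imC (L' p)).symm
  have h3 := hcross _ _ hxy
  have h4 := hcross _ _ hxy'
  have hBn : ∀ a b : E, B (-a) b = -B a b := fun a b => by rw [map_neg, neg_apply]
  have h5 : ∀ (x y : E), B u y + B u' x = 0 → B u x + B u' (-y) = 0 →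
      ((dForm η.form p (-u') x).im - (dForm η.form p u y).im) = 0 ∧
      -((dForm η.form p u x).im + (dForm η.form p (-u') y).im) = 0 := fun x y ha hb => by
    have h6 : (dForm η.form p (-u') x).im = -B u' x := (hBd (-u') x).trans (hBn u' x)
    have h7 : (dForm η.form p (-u') y).im = -B u' y := (hBd (-u') y).trans (hBn u' y)
    have h8 := hBd u y
    have h9 := hBd u x
    have h10 : B u' (-y) = -B u' y := map_neg _ _
    constructor <;> linarith
  obtain ⟨h6, h7⟩ := h5 _ _ h3 h4
  exact Complex.ext (h1.trans h6) (h2.trans h7)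

end Trivialization

end CRStructure

/-! ### Pulling back `1`-forms along immersions. -/

section Immersion

variable {E : Type*} [NormedAddCommGroup E] [NormedSpace ℝ E]
  {M : Type*} [TopologicalSpace M] [ChartedSpace E M] [IsManifold 𝓘(ℝ, E) ∞ M]
  {F : Type*} [NormedAddCommGroup F] [NormedSpace ℝ F]
  {A : Type*} [TopologicalSpace A] [ChartedSpace F A] [IsManifold 𝓘(ℝ, F) ∞ A]

omit [IsManifold 𝓘(ℝ, E) ∞ M] [IsManifold 𝓘(ℝ, F) ∞ A] in
/-- The differential of an immersion is injective. -/
lemma mfderiv_injective_of_isImmersionAt {f : A → M} {a : A}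
    (h : IsImmersionAt 𝓘(ℝ, F) 𝓘(ℝ, E) ∞ f a) :
    Function.Injective (mfderiv 𝓘(ℝ, F) 𝓘(ℝ, E) f a) := by
  -- In suitable charts the immersion is `u ↦ (u, 0)`; the first component recovers `u`, so `g` is a
  -- smooth local left inverse of `f`.
  let P : E → F := fun y => (h.equiv.symm y).1
  let g : M → A := h.domChart.symm ∘ P ∘ h.codChart
  have hP : ContDiff ℝ ∞ P := contDiff_fst.comp h.equiv.symm.contDiff
  have hleft : ∀ q ∈ h.domChart.source, P (h.codChart (f q)) = h.domChart q := by
    intro q hq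
    have hq' : h.domChart q ∈ (h.domChart.extend 𝓘(ℝ, F)).target := by
      simpa using h.domChart.map_source hq
    have h1 := h.writtenInCharts hq'
    simp only [Function.comp_apply, OpenPartialHomeomorph.extend_coe, modelWithCornersSelf_coe,
      OpenPartialHomeomorph.extend_coe_symm, modelWithCornersSelf_coe_symm, id_eq,
      h.domChart.left_inv hq] at h1
    simp only [P, h1, ContinuousLinearEquiv.symm_apply_apply]
  have hPa : (P ∘ h.codChart) (f a) = h.domChart a := hleft a h.mem_domChart_source
  have hg : ContMDiffAt 𝓘(ℝ, E) 𝓘(ℝ, F) ∞ g (f a) := by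
    refine ContMDiffAt.comp (f a) (I' := 𝓘(ℝ, F)) ?_ (ContMDiffAt.comp (f a) hP.contMDiff.contMDiffAt
      (contMDiffAt_of_mem_maximalAtlas h.codChart_mem_maximalAtlas h.mem_codChart_source))
    rw [hPa]
    exact contMDiffAt_symm_of_mem_maximalAtlas h.domChart_mem_maximalAtlas
      (h.domChart.map_source h.mem_domChart_source)
  have hid : g ∘ f =ᶠ[𝓝 a] id := by
    filter_upwards [h.domChart.open_source.mem_nhds h.mem_domChart_source] with q hq
    simp only [g, Function.comp_apply, hleft q hq, h.domChart.left_inv hq, id_eq]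
  have h2 := mfderiv_comp a (hg.mdifferentiableAt (by simp)) (h.contMDiffAt.mdifferentiableAt (by simp))
  rw [hid.mfderiv_eq, mfderiv_id] at h2
  intro v w hvw
  have h3 := congrArg (fun φ : F →L[ℝ] F => φ v) h2
  have h4 := congrArg (fun φ : F →L[ℝ] F => φ w) h2
  refine Eq.trans h3 (Eq.trans ?_ h4.symm)
  exact congrArg (mfderiv 𝓘(ℝ, E) 𝓘(ℝ, F) g (f a)) hvw

variable {f : A → M} (hf : ContMDiff 𝓘(ℝ, F) 𝓘(ℝ, E) ∞ f)

include hf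

omit [IsManifold 𝓘(ℝ, E) ∞ M] in
lemma contMDiffAt_comp_chartAt_symm (a : A) {y : F} (hy : y ∈ (chartAt F a).target) :
    ContMDiffAt 𝓘(ℝ, F) 𝓘(ℝ, E) ∞ (f ∘ (chartAt F a).symm) y :=
  hf.contMDiffAt.comp y (contMDiffAt_chartAt_symm a hy)

omit [IsManifold 𝓘(ℝ, E) ∞ M] in
lemma mfderiv_comp_chartAt_symm (a : A) {y : F} (hy : y ∈ (chartAt F a).target) :
    mfderiv 𝓘(ℝ, F) 𝓘(ℝ, E) (f ∘ (chartAt F a).symm) y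
      = (mfderiv 𝓘(ℝ, F) 𝓘(ℝ, E) f ((chartAt F a).symm y)).comp
        (mfderiv 𝓘(ℝ, F) 𝓘(ℝ, F) (chartAt F a).symm y) :=
  mfderiv_comp y (hf.contMDiffAt.mdifferentiableAt (by simp))
    ((contMDiffAt_chartAt_symm a hy).mdifferentiableAt (by simp))

variable {N : Type*} [NormedAddCommGroup N] [NormedSpace ℝ N]
  {G : ∀ q : M, TangentSpace 𝓘(ℝ, E) q →L[ℝ] N}

lemma extd_pullbackForm_chartAt (a : A) (hG : SmoothForm G (f a)) (v w : F) :
    extd (pullbackForm (f ∘ (chartAt F a).symm) G) (chartAt F a a) v w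
      = dForm G (f a) (mfderiv 𝓘(ℝ, F) 𝓘(ℝ, E) f a v) (mfderiv 𝓘(ℝ, F) 𝓘(ℝ, E) f a w) := by
  have ha : (chartAt F a).symm (chartAt F a a) = a := (chartAt F a).left_inv (mem_chart_source F a)
  have hd : ∀ v : F, (mfderiv 𝓘(ℝ, F) 𝓘(ℝ, E) (f ∘ (chartAt F a).symm) (chartAt F a a) v : E)
      = mfderiv 𝓘(ℝ, F) 𝓘(ℝ, E) f a v := by
    intro v
    let D : A → F →L[ℝ] E := fun a => mfderiv 𝓘(ℝ, F) 𝓘(ℝ, E) f a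
    have h1 := congrArg (fun φ : F →L[ℝ] E => φ v)
      (mfderiv_comp_chartAt_symm hf a (mem_chart_target F a))
    refine h1.trans (Eq.trans ?_ (congrArg (fun b => D b v) ha))
    exact congrArg (D _) (mfderiv_chartAt_symm_self a v)
  let D2 : M → E →L[ℝ] E →L[ℝ] N := dForm G
  have hfa : (f ∘ (chartAt F a).symm) (chartAt F a a) = f a := congrArg f ha
  have h2 := (pullbackForm_spec (φ := f ∘ (chartAt F a).symm) (x := chartAt F a a) (G := G)
    (by
      filter_upwards [eventually_mem_target a] with y hy using contMDiffAt_comp_chartAt_symm hf a hy)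
    (by rwa [hfa])).2 v w
  refine h2.trans ?_
  refine (congrArg₂ (fun v w : E => D2 _ v w) (hd v) (hd w)).trans ?_
  exact congrArg (fun p => D2 p (mfderiv 𝓘(ℝ, F) 𝓘(ℝ, E) f a v) (mfderiv 𝓘(ℝ, F) 𝓘(ℝ, E) f a w)) hfa

/-- A smooth real one-form whose exterior derivative pulls back to a nondegenerate form gives a
symplectic potential. -/
lemma isSymplecticPotential_pullbackForm {G : ∀ q : M, TangentSpace 𝓘(ℝ, E) q →L[ℝ] ℝ}
    (hG : ∀ p, SmoothForm G p)
    (hnd : ∀ a (v : TangentSpace 𝓘(ℝ, F) a), v ≠ 0 → ∃ w : TangentSpace 𝓘(ℝ, F) a,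
      dForm G (f a) (mfderiv 𝓘(ℝ, F) 𝓘(ℝ, E) f a v) (mfderiv 𝓘(ℝ, F) 𝓘(ℝ, E) f a w) ≠ 0) :
    IsSymplecticPotential (A := A) (F := F)
      fun a => pullbackForm (f ∘ (chartAt F a).symm) G where
  smooth a x hx := (pullbackForm_spec (by
      filter_upwards [(chartAt F a).open_target.mem_nhds hx] with y hy
        using contMDiffAt_comp_chartAt_symm hf a hy) (hG _)).1
  transition a a' x hx := by
    have h1 : f ∘ (chartAt F a).symm =ᶠ[𝓝 x] (f ∘ (chartAt F a').symm) ∘ transition F a a' := by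
      filter_upwards [(isOpen_overlap a a').mem_nhds hx] with y hy
      simp only [Function.comp_apply, transition]
      rw [(chartAt F a').left_inv hy.2]
    have hx' : transition F a a' x ∈ (chartAt F a').target := (chartAt F a').map_source hx.2
    have h2 := mfderiv_comp x
      ((contMDiffAt_comp_chartAt_symm hf a' hx').mdifferentiableAt (by simp))
      ((contDiffAt_transition hx).contMDiffAt.mdifferentiableAt (by simp))
    rw [← h1.mfderiv_eq, mfderiv_eq_fderiv] at h2
    have h3 : (f ∘ (chartAt F a).symm) x = (f ∘ (chartAt F a').symm) (transition F a a' x) :=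
      h1.eq_of_nhds
    let G' : M → E →L[ℝ] ℝ := G
    let D : F →L[ℝ] E := mfderiv 𝓘(ℝ, F) 𝓘(ℝ, E) (f ∘ (chartAt F a).symm) x
    have h4 : (G' ((f ∘ (chartAt F a).symm) x)).comp D
      = (G' ((f ∘ (chartAt F a').symm) (transition F a a' x))).comp D := by rw [h3]
    refine h4.trans ?_
    exact congrArg (G' ((f ∘ (chartAt F a').symm) (transition F a a' x))).comp h2
  nondegenerate a v h := by
    by_contra hv
    obtain ⟨w, hw⟩ := hnd a v hv
    exact hw ((extd_pullbackForm_chartAt hf a (hG _) v w).symm.trans (h w))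

end Immersion

/-! ### The real structure of a complex manifold. -/

section ComplexManifold

variable {F : Type*} [NormedAddCommGroup F] [NormedSpace ℂ F]
  {A : Type*} [TopologicalSpace A] [ChartedSpace F A]

/-- The smooth manifold underlying a complex manifold. -/
lemma isManifold_real [IsManifold 𝓘(ℂ, F) ω A] : IsManifold 𝓘(ℝ, F) ∞ A := by
  refine isManifold_of_contDiffOn _ _ _ fun e e' he he' => ?_
  have h := (contDiffGroupoid ω 𝓘(ℂ, F)).compatible he he'
  rw [contDiffGroupoid, mem_groupoid_of_pregroupoid] at h
  have h1 : ContDiffOn ℂ ω _ _ := h.1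
  exact (h1.restrict_scalars ℝ).of_le le_top

/-- `J² = -1` gives `J(v - iJv) = Jv + iv = i(v - iJv)`. -/
lemma mkC_mem_holTangent (a : A) (v : TangentSpace 𝓘(ℝ, F) a) :
    mkC v (-complexStructure F a v) ∈ holTangent F a := by
  have hJ : complexStructure F a (complexStructure F a v) = -v := by
    have h : ∀ w : F, Complex.I • Complex.I • w = -w := fun w => by
      rw [smul_smul, Complex.I_mul_I, neg_one_smul]
    exact h v
  rw [holTangent, Module.End.mem_eigenspace_iff]
  simp only [mkC, map_add, LinearMap.baseChange_tmul, map_neg, hJ, smul_add,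
    TensorProduct.smul_tmul', smul_eq_mul, mul_one, Complex.I_mul_I, TensorProduct.tmul_neg,
    TensorProduct.neg_tmul, neg_neg, smul_neg]
  abel

end ComplexManifold

/-! ### Compact complex submanifolds of a CR manifold. -/

namespace CRStructure

variable {E : Type*} [NormedAddCommGroup E] [NormedSpace ℝ E] [FiniteDimensional ℝ E]
  {M : Type*} [TopologicalSpace M] [T2Space M] [ChartedSpace E M] [IsManifold 𝓘(ℝ, E) ∞ M] {n : ℕ}
  {C : CRStructure E M n}
  {F : Type*} [NormedAddCommGroup F] [NormedSpace ℂ F]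
  {A : Type*} [TopologicalSpace A] [ChartedSpace F A] {ι : A → M}

section

omit [FiniteDimensional ℝ E] [T2Space M]

lemma IsCREmbedding.mkC_mem_T10 (hι : C.IsCREmbedding (F := F) ι) (a : A)
    (v : TangentSpace 𝓘(ℝ, F) a) :
    mkC (mfderiv 𝓘(ℝ, F) 𝓘(ℝ, E) ι a v)
      (-mfderiv 𝓘(ℝ, F) 𝓘(ℝ, E) ι a (complexStructure F a v)) ∈ C.T10 (ι a) := by
  have h := hι.map_T10 a _ (mkC_mem_holTangent a v)
  simpa [mkC, LinearMap.baseChange_tmul] using h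

lemma IsCREmbedding.form_mfderiv (hι : C.IsCREmbedding (F := F) ι) (η : C.Trivialization) (a : A)
    (v : TangentSpace 𝓘(ℝ, F) a) : η.form (ι a) (mfderiv 𝓘(ℝ, F) 𝓘(ℝ, E) ι a v) = 0 := by
  have h := (η.form_reC_imC (hι.mkC_mem_T10 a v)).1
  rwa [reC_mkC] at h

end

variable [IsManifold 𝓘(ℝ, F) ∞ A] {η : C.Trivialization}

omit [T2Space M] in
-- `η` vanishes on vectors tangent to `ι(A)`, so its pullback to `A` is zero, and `d` commutes with
-- pullback.
lemma IsCREmbedding.dForm_mfderiv (hι : C.IsCREmbedding (F := F) ι) (T : η.Transversal) (a : A)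
    (v w : TangentSpace 𝓘(ℝ, F) a) : dForm η.form (ι a) (mfderiv 𝓘(ℝ, F) 𝓘(ℝ, E) ι a v)
      (mfderiv 𝓘(ℝ, F) 𝓘(ℝ, E) ι a w) = 0 := by
  have hs := hι.embedding.contMDiff
  rw [← extd_pullbackForm_chartAt hs a (T.smoothForm_form _) v w]
  have h0 : pullbackForm (ι ∘ (chartAt F a).symm) η.form =ᶠ[𝓝 (chartAt F a a)] fun _ => 0 := by
    filter_upwards [eventually_mem_target a] with y hy
    ext u
    have h1 := congrArg (fun φ : F →L[ℝ] E => φ u) (mfderiv_comp_chartAt_symm hs a hy)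
    exact (congrArg (η.form (ι ((chartAt F a).symm y))) h1).trans (hι.form_mfderiv η _ _)
  rw [extd_congr h0]
  have h1 : ∀ x v w : F, extd (fun _ : F => (0 : F →L[ℝ] ℂ)) x v w = 0 := fun x v w => by
    simp [extd_apply]
  exact h1 _ v w

/-- On a compact complex submanifold the quadratic form `∂̄_b ω_η` vanishes on some nonzero null
vector. -/
lemma IsCREmbedding.exists_re_dbarOmega_eq_zero [FiniteDimensional ℝ F] [Nontrivial F]
    [T2Space A] [CompactSpace A] [Nonempty A] (hι : C.IsCREmbedding (F := F) ι)
    (hη : η.IsPositive) (T : η.Transversal) :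
    ∃ p ∈ range ι, ∃ L : CField E M, C.IsSection10 L ∧ L p ∈ η.nullSpace p ∧ L p ≠ 0 ∧
      (T.dbarOmega L L p).re = 0 := by
  by_contra! hne
  have hIm := fun p => dForm_clm_comp (T.smoothForm_omegaForm p) Complex.imCLM
  -- The potential is the pullback of `Im ω_η`. The witness for nondegeneracy at `v` is `Jv`, where
  -- the two-form is half of `Re ∂̄_b ω_η`; only its nonvanishing matters, which treats both signs
  -- at once.
  refine not_isSymplecticPotential _ (isSymplecticPotential_pullbackForm (A := A) (F := F)
    hι.embedding.contMDiff (fun p => (hIm p).1) fun a v hv => ⟨complexStructure F a v, ?_⟩)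
  have hz := hι.mkC_mem_T10 a v
  obtain ⟨L, hL, hLp⟩ := C.exists_section hz
  have hnull := Trivialization.mem_nullSpace hη T hz (hι.dForm_mfderiv T a v _)
  have h0 : L (ι a) ≠ 0 := by
    intro h
    have h1 := congrArg reC (hLp.symm.trans h)
    rw [reC_mkC, map_zero] at h1
    refine hv (mfderiv_injective_of_isImmersionAt
      (hι.embedding.isImmersion.isImmersionAt a) (h1.trans ?_))
    rw [map_zero]
  have h1 := hne (ι a) (mem_range_self a) L hL (by rwa [hLp]) h0
  rw [T.re_dbarOmega hL hLp] at h1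
  intro h2
  apply h1
  have h3 := ((hIm (ι a)).2 _ _).symm.trans h2
  rw [Complex.imCLM_apply] at h3
  rw [h3, mul_zero]

/-- At the null vector where `Re ∂̄_b ω_η` vanishes, the expression reduces to `-b |ω_η|² ≤ 0`,
whatever the sign of `c`. Both sign statements and both indices are special cases. -/
lemma IsCREmbedding.not_posOnNull [FiniteDimensional ℝ F] [Nontrivial F]
    [T2Space A] [CompactSpace A] [Nonempty A] (hι : C.IsCREmbedding (F := F) ι)
    (hη : η.IsPositive) (T : η.Transversal) {S : Set M} (hS : range ι ⊆ S) (c : ℝ) {b : ℝ}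
    (hb : 0 ≤ b) : ¬ T.PosOnNull c b S := by
  intro h
  obtain ⟨p, hp, L, hL, hnull, hne, h0⟩ := hι.exists_re_dbarOmega_eq_zero hη T
  have h1 := h p (hS hp) L hL hnull hne
  rw [h0] at h1
  nlinarith [mul_nonneg hb (sq_nonneg ‖T.omega L p‖)]

end CRStructure

end CRGeometry

end

theorem mainTheorem5
    {E : Type*} [NormedAddCommGroup E] [NormedSpace ℝ E] [FiniteDimensional ℝ E]
    {M : Type*} [TopologicalSpace M] [T2Space M] [CompactSpace M]
    [ChartedSpace E M] [IsManifold 𝓘(ℝ, E) ∞ M] {n : ℕ}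
    (C : CRGeometry.CRStructure E M n) (hC : C.IsPseudoconvex)
    {F : Type*} [NormedAddCommGroup F] [NormedSpace ℂ F] [FiniteDimensional ℂ F] [Nontrivial F]
    {A : Type*} [TopologicalSpace A] [T2Space A] [CompactSpace A] [Nonempty A]
    [ChartedSpace F A] [IsManifold 𝓘(ℂ, F) ω A]
    (ι : A → M) (hι : C.IsCREmbedding (F := F) ι) :
    (∀ η : C.Trivialization, η.IsPositive → ∀ T : η.Transversal,
        ¬ T.DbarOmegaPos (Set.range ι) ∧ ¬ T.DbarOmegaNeg (Set.range ι)) ∧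
      C.DFs = 0 ∧ C.Ss = ⊤ := by
  have : IsManifold 𝓘(ℝ, F) ∞ A := CRGeometry.isManifold_real
  have : FiniteDimensional ℝ F := FiniteDimensional.complexToReal F
  refine ⟨fun η hη T => ⟨hι.not_posOnNull hη T subset_rfl _ le_rfl,
    hι.not_posOnNull hη T subset_rfl _ le_rfl⟩, ?_, ?_⟩
  · rw [CRGeometry.CRStructure.DFs]
    refine (congrArg sSup (Set.eq_empty_of_forall_notMem ?_)).trans Real.sSup_empty
    rintro γ ⟨h0, h1, η, hη, T, hT⟩
    exact hι.not_posOnNull hη T (Set.subset_univ _) _ (div_nonneg h0.le (by linarith)) hT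
  · rw [CRGeometry.CRStructure.Ss]
    refine (congrArg sInf (Set.image_eq_empty.2 (Set.eq_empty_of_forall_notMem ?_))).trans sInf_empty
    rintro γ ⟨h1, η, hη, T, hT⟩
    exact hι.not_posOnNull hη T (Set.subset_univ _) _ (div_nonneg (by linarith) (by linarith)) hT
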